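/- **Setting.** Let $f:[0,\infty)\times\mathbb R^n\times\mathbb R^m\to\mathbb R^n$ and $l:[0,\infty)\times\mathbb R^n\times\mathbb R^m\to\mathbb R$ be continuous, let $\delta>0$, and let $\Omega\subset\mathbb R^m$ be non-empty and compact. Suppose that there are $K_1,K_2>0$ such that, for all $t\ge 0$, $u\in\Omega$ and $x,z\in\mathbb R^n$, $$|l(t,x,u)-l(t,z,u)|+|f(t,x,u)-f(t,z,u)|\le K_1|x-z|,\qquad |l(t,x,u)|+|f(t,x,u)|\le K_2(1+|x|),$$ and that $\{(e^{-\delta t}l(t,x,v),f(t,x,v)) : v\in\Omega\}\subset\mathbb R^{n+1}$ is convex for all $t\ge0$, $x\in\mathbb R^n$. For $(s,z)\in[0,\infty)\times\mathbb R^n$, an *admissible process* from $(s,z)$ is a pair $(x,u)$ with $u\in L^1_{loc}([s,\infty);\mathbb R^m)$, $u(t)\in\Omega$ for a.e. $t\ge s$, and $x(t)=z+\int_s^t f(r,x(r),u(r))\,dr$ for all $t\ge s$ (with locally integrable integrand). Let $\mathcal D_{s,z;\infty}$ be the set of those whose cost $\int_s^\infty e^{-\delta t}l(t,x(t),u(t))\,dt$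 exists as a finite Lebesgue integral. Put $$\mathcal H(t,x,\xi)=\inf_{u\in\Omega}\{\langle\xi,f(t,x,u)\rangle+e^{-\delta t}l(t,x,u)\},\qquad \hat{\mathcal H}(t,x,\xi)=\sup_{u\in\Omega}\{\langle\xi,f(t,x,u)\rangle+e^{-\delta t}l(t,x,u)\}.$$ For $\varphi:[0,\infty)\times\mathbb R^n\to\mathbb R$, let $\partial_P\varphi(t,x)$ be the set of $(\alpha,\xi)\in\mathbb R\times\mathbb R^n$ for which there are $\sigma>0$ and a neighbourhood $U$ of $(t,x)$ in $[0,\infty)\times\mathbb R^n$ with $$\varphi(\tau,y)\ge\varphi(t,x)+\alpha(\tau-t)+\langle\xi,y-x\rangle-\sigma(|\tau-t|^2+|y-x|^2)\quad\text{for all }(\tau,y)\in U.$$ Infima and suprema over $\partial_P\varphi$ are taken in $[-\infty,\infty]$, with $\inf\emptyset=+\infty$, $\sup\emptyset=-\infty$. **Proposition.** Let $\varphi:[0,\infty)\times\mathbb R^n\to\mathbb R$ be continuous and, for $(x,u)\in\mathcal D_{s,z;\infty}$, put $$G_{x,u}:[s,\infty)\to\mathbb R,\qquad G_{x,u}(t)=\varphi(t,x(t))-\int_t^\infty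 e^{-\delta\sigma}l(\sigma,x(\sigma),u(\sigma))\,d\sigma .$$ (a) Consider the statements - (a1) for all $(s,z)\in[0,\infty)\times\mathbb R^n$ and every $(x,u)\in\mathcal D_{s,z;\infty}$, $G_{x,u}$ is non-decreasing; - (a2) $\inf_{(\alpha,\xi)\in\partial_P\varphi(s,z)}\{\alpha+\mathcal H(s,z,\xi)\}\ge0$ for all $(s,z)\in(0,\infty)\times\mathbb R^n$. Then (a2) implies (a1); and (a1) implies (a2) if $\mathcal D_{\tau,y;\infty}\ne\emptyset$ for all $(\tau,y)\in[0,\infty)\times\mathbb R^n$. (b) Consider the statements - (b1) for all $(s,z)\in[0,\infty)\times\mathbb R^n$ and every $(x,u)\in\mathcal D_{s,z;\infty}$, $G_{x,u}$ is non-increasing; - (b2) $\sup_{(\alpha,\xi)\in\partial_P\varphi(s,z)}\{\alpha+\hat{\mathcal H}(s,z,\xi)\}\le0$ for all $(s,z)\in[0,\infty)\times\mathbb R^n$. Then (b2) implies (b1); and (b1) implies (b2) if $\mathcal D_{\tau,y;\infty}\ne\emptyset$ for all $(\tau,y)\in[0,\infty)\times\mathbb R^n$. (c) Consider the statements - (c1)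 for all $(s,z)\in[0,\infty)\times\mathbb R^n$ there is $(x,u)\in\mathcal D_{s,z;\infty}$ for which $G_{x,u}$ is non-increasing; - (c2) $\sup_{(\alpha,\xi)\in\partial_P\varphi(s,z)}\{\alpha+\mathcal H(s,z,\xi)\}\le0$ for all $(s,z)\in[0,\infty)\times\mathbb R^n$. Then (c1) implies (c2); and (c2) implies (c1) if every admissible process from every $(\tau,y)\in[0,\infty)\times\mathbb R^n$ has finite cost, i.e. belongs to $\mathcal D_{\tau,y;\infty}$. In particular, if every admissible process has finite cost, then all three equivalences (a1)$\Leftrightarrow$(a2), (b1)$\Leftrightarrow$(b2), (c1)$\Leftrightarrow$(c2) hold. -/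

import Mathlib

open Set Filter Topology MeasureTheory

/-- Data of the infinite horizon optimal control problem with states in `ℝⁿ` and controls in `ℝᵐ`.
Only times `t ≥ 0` are ever used; the values of `f`, `l` at negative times are irrelevant. -/
structure ControlProblem (n m : ℕ) where
  /-- the dynamics -/
  f : ℝ → EuclideanSpace ℝ (Fin n) → EuclideanSpace ℝ (Fin m) → EuclideanSpace ℝ (Fin n)
  /-- the running cost -/
  l : ℝ → EuclideanSpace ℝ (Fin n) → EuclideanSpace ℝ (Fin m) → ℝ
  /-- the set of admissible control actions -/
  Ω : Set (EuclideanSpace ℝ (Fin m))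
  /-- the discount rate -/
  δ : ℝ

namespace ControlProblem

variable {n m : ℕ}

/-- The standing assumptions on the data. -/
structure Standing (P : ControlProblem n m) : Prop where
  discount_pos : 0 < P.δ
  controls_nonempty : P.Ω.Nonempty
  lipschitz : ∃ K₁ : ℝ, 0 < K₁ ∧ ∀ t : ℝ, 0 ≤ t → ∀ u ∈ P.Ω, ∀ x z : EuclideanSpace ℝ (Fin n),
    |P.l t x u - P.l t z u| + ‖P.f t x u - P.f t z u‖ ≤ K₁ * ‖x - z‖
  growth : ∃ K₂ : ℝ, 0 < K₂ ∧ ∀ t : ℝ, 0 ≤ t → ∀ x : EuclideanSpace ℝ (Fin n), ∀ u ∈ P.Ω,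
    |P.l t x u| + ‖P.f t x u‖ ≤ K₂ * (1 + ‖x‖)
  continuous_l : ContinuousOn
    (fun p : ℝ × EuclideanSpace ℝ (Fin n) × EuclideanSpace ℝ (Fin m) => P.l p.1 p.2.1 p.2.2)
    {p | 0 ≤ p.1}
  continuous_f : ContinuousOn
    (fun p : ℝ × EuclideanSpace ℝ (Fin n) × EuclideanSpace ℝ (Fin m) => P.f p.1 p.2.1 p.2.2)
    {p | 0 ≤ p.1}
  convex_velocities : ∀ t : ℝ, 0 ≤ t → ∀ x : EuclideanSpace ℝ (Fin n),
    Convex ℝ ((fun v => (Real.exp (-P.δ * t) * P.l t x v, P.f t x v)) '' P.Ω)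
  compact_controls : IsCompact P.Ω

/-- `(x, u)` is an admissible process starting at time `τ` in the state `z`: the control `u` is
locally integrable on `[τ, ∞)` with values in `Ω` almost everywhere, and `x` solves the state
equation in integral form on `[τ, ∞)`. Local integrability of the right-hand side makes `x`
absolutely continuous on compact intervals. -/
structure IsAdmissible (P : ControlProblem n m) (τ : ℝ) (z : EuclideanSpace ℝ (Fin n))
    (x : ℝ → EuclideanSpace ℝ (Fin n)) (u : ℝ → EuclideanSpace ℝ (Fin m)) : Prop where
  control_locallyIntegrable : LocallyIntegrableOn u (Ici τ)
  control_mem : ∀ᵐ t ∂(volume.restrict (Ici τ)), u t ∈ P.Ω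
  velocity_locallyIntegrable : LocallyIntegrableOn (fun r => P.f r (x r) (u r)) (Ici τ)
  state_eq : ∀ t, τ ≤ t → x t = z + ∫ r in τ..t, P.f r (x r) (u r)

/-- The discounted running cost along a process. -/
noncomputable def discountedCost (P : ControlProblem n m)
    (x : ℝ → EuclideanSpace ℝ (Fin n)) (u : ℝ → EuclideanSpace ℝ (Fin m)) (t : ℝ) : ℝ :=
  Real.exp (-P.δ * t) * P.l t (x t) (u t)

/-- The set of admissible processes from `(τ, z)` with finite cost, that is, whose cost integral
over `[τ, ∞)` exists (as a Lebesgue integral) and is finite. -/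
def finiteCostProcesses (P : ControlProblem n m) (τ : ℝ) (z : EuclideanSpace ℝ (Fin n)) :
    Set ((ℝ → EuclideanSpace ℝ (Fin n)) × (ℝ → EuclideanSpace ℝ (Fin m))) :=
  {p | P.IsAdmissible τ z p.1 p.2 ∧ IntegrableOn (P.discountedCost p.1 p.2) (Ioi τ)}

/-- The function `t ↦ φ(t, x(t)) - ∫_t^∞ e^{-δσ} l(σ, x(σ), u(σ)) dσ`. -/
noncomputable def pathValue (P : ControlProblem n m) (φ : ℝ → EuclideanSpace ℝ (Fin n) → ℝ)
    (x : ℝ → EuclideanSpace ℝ (Fin n)) (u : ℝ → EuclideanSpace ℝ (Fin m)) (t : ℝ) : ℝ :=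
  φ t (x t) - ∫ σ in Ioi t, P.discountedCost x u σ

/-- The Hamilton function `H(t, x, ξ, u) = ⟨ξ, f(t, x, u)⟩ + e^{-δt} l(t, x, u)`. -/
noncomputable def preHamiltonian (P : ControlProblem n m) (t : ℝ)
    (x ξ : EuclideanSpace ℝ (Fin n)) (u : EuclideanSpace ℝ (Fin m)) : ℝ :=
  inner ℝ ξ (P.f t x u) + Real.exp (-P.δ * t) * P.l t x u

/-- The minimised Hamiltonian. -/
noncomputable def hamiltonian (P : ControlProblem n m) (t : ℝ)
    (x ξ : EuclideanSpace ℝ (Fin n)) : ℝ :=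
  sInf (P.preHamiltonian t x ξ '' P.Ω)

/-- The maximised Hamiltonian. -/
noncomputable def maxHamiltonian (P : ControlProblem n m) (t : ℝ)
    (x ξ : EuclideanSpace ℝ (Fin n)) : ℝ :=
  sSup (P.preHamiltonian t x ξ '' P.Ω)

end ControlProblem

/-- The proximal sub-gradient at `(t, x)` of a function `φ` with domain `[0, ∞) × ℝⁿ`.
Neighbourhoods are taken in that domain. -/
def proximalSubgradient {n : ℕ} (φ : ℝ → EuclideanSpace ℝ (Fin n) → ℝ) (t : ℝ)
    (x : EuclideanSpace ℝ (Fin n)) : Set (ℝ × EuclideanSpace ℝ (Fin n)) :=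
  {p | ∃ σ : ℝ, 0 < σ ∧
    ∀ᶠ q : ℝ × EuclideanSpace ℝ (Fin n) in 𝓝[{q | 0 ≤ q.1}] (t, x),
      φ t x + p.1 * (q.1 - t) + inner ℝ p.2 (q.2 - x)
        - σ * (|q.1 - t| ^ 2 + ‖q.2 - x‖ ^ 2) ≤ φ q.1 q.2}

namespace ControlProblem

variable {n m : ℕ}

/-- `inf {α + 𝓗(s, z, ξ) | (α, ξ) ∈ ∂_P φ(s, z)}`, an extended real (`⊤` on the empty set). -/
noncomputable def infHJB (P : ControlProblem n m) (φ : ℝ → EuclideanSpace ℝ (Fin n) → ℝ)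
    (s : ℝ) (z : EuclideanSpace ℝ (Fin n)) : EReal :=
  ⨅ p ∈ proximalSubgradient φ s z, ((p.1 + P.hamiltonian s z p.2 : ℝ) : EReal)

/-- `sup {α + 𝓗(s, z, ξ) | (α, ξ) ∈ ∂_P φ(s, z)}`, an extended real (`⊥` on the empty set). -/
noncomputable def supHJB (P : ControlProblem n m) (φ : ℝ → EuclideanSpace ℝ (Fin n) → ℝ)
    (s : ℝ) (z : EuclideanSpace ℝ (Fin n)) : EReal :=
  ⨆ p ∈ proximalSubgradient φ s z, ((p.1 + P.hamiltonian s z p.2 : ℝ) : EReal)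

/-- The same supremum with the maximised Hamiltonian. -/
noncomputable def supMaxHJB (P : ControlProblem n m) (φ : ℝ → EuclideanSpace ℝ (Fin n) → ℝ)
    (s : ℝ) (z : EuclideanSpace ℝ (Fin n)) : EReal :=
  ⨆ p ∈ proximalSubgradient φ s z, ((p.1 + P.maxHamiltonian s z p.2 : ℝ) : EReal)

/-- From every initial condition, non-decreasing along every process with finite cost. -/
def NondecreasingAlongEvery (P : ControlProblem n m)
    (φ : ℝ → EuclideanSpace ℝ (Fin n) → ℝ) : Prop :=
  ∀ s : ℝ, 0 ≤ s → ∀ z : EuclideanSpace ℝ (Fin n), ∀ p ∈ P.finiteCostProcesses s z,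
    MonotoneOn (P.pathValue φ p.1 p.2) (Ici s)

/-- From every initial condition, non-increasing along every process with finite cost. -/
def NonincreasingAlongEvery (P : ControlProblem n m)
    (φ : ℝ → EuclideanSpace ℝ (Fin n) → ℝ) : Prop :=
  ∀ s : ℝ, 0 ≤ s → ∀ z : EuclideanSpace ℝ (Fin n), ∀ p ∈ P.finiteCostProcesses s z,
    AntitoneOn (P.pathValue φ p.1 p.2) (Ici s)

/-- From every initial condition, non-increasing along some process with finite cost. -/
def NonincreasingAlongSome (P : ControlProblem n m)
    (φ : ℝ → EuclideanSpace ℝ (Fin n) → ℝ) : Prop :=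
  ∀ s : ℝ, 0 ≤ s → ∀ z : EuclideanSpace ℝ (Fin n), ∃ p ∈ P.finiteCostProcesses s z,
    AntitoneOn (P.pathValue φ p.1 p.2) (Ici s)

end ControlProblem

/-!
Let `V` be the inf-convolution of `φ` with a steep quadratic. It is uniformly close to `φ` on
compact sets and has global proximal supergradients, which are proximal subgradients of `φ` at
nearby points with almost the same Hamiltonian. So over a short time step the increment of `V` plus
the cost along a process is at most the time integral of `α + H(t, x, ξ, u)`, up to `ε` times the
step, for some `(α, ξ)` in a proximal subdifferential of `φ`. Summing over the steps and letting
`ε → 0` gives (b2) ⇒ (b1), and, with time running backward from the right end of each step,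
(a2) ⇒ (a1). For (c2) ⇒ (c1), the same estimate is applied to Euler polygons of a feedback for which
`α + H` is almost non-positive at the supergradients of `V`; as the velocities are convex, limits of
such polygons are trajectories by Filippov's lemma.

Conversely, a proximal subgradient `(α, ξ)` of `φ` at `(s, z)` is compared with the increment of `φ`
along a process through `(s, z)`: one with constant control on a short interval in (a1) and (b1),
where finite cost processes from every point allow its continuation, and the given one in (c1).
-/

lemma nonpos_of_eventually_le_mul {a K : ℝ} (h : ∀ᶠ ε in 𝓝[>] (0 : ℝ), a ≤ ε * K) : a ≤ 0 := by
  have hlim : Tendsto (fun ε : ℝ => ε * K) (𝓝[>] 0) (𝓝 0) := by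
    simpa only [id, zero_mul] using
      ((tendsto_id (α := ℝ)).mul_const K).mono_left (nhdsWithin_le_nhds (a := 0) (s := Ioi 0))
  exact ge_of_tendsto hlim h

lemma exists_pos_forall_mul_sq_le_imp_lt (M : ℝ) {η : ℝ} (hη : 0 < η) :
    ∃ σ : ℝ, 0 < σ ∧ ∀ d : ℝ, σ * d ^ 2 ≤ M → |d| < η := by
  refine ⟨(|M| + 1) / η ^ 2, by positivity, fun d hd => ?_⟩
  by_contra! hηd
  have hle : (|M| + 1) / η ^ 2 * η ^ 2 ≤ (|M| + 1) / η ^ 2 * d ^ 2 := by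
    rw [← sq_abs d]
    gcongr
  rw [div_mul_cancel₀ _ (by positivity)] at hle
  linarith [le_abs_self M]

lemma sub_le_mul_of_forall_short {F : ℝ → ℝ} {a b c η : ℝ} (hab : a ≤ b) (hη : 0 < η)
    (h : ∀ t ∈ Icc a b, ∀ t' ∈ Icc a b, t ≤ t' → t' - t < η → F t' - F t ≤ c * (t' - t)) :
    F b - F a ≤ c * (b - a) := by
  have key : ∀ N : ℕ, ∀ t ∈ Icc a b, t - a ≤ N * (η / 2) → F t - F a ≤ c * (t - a) := by
    intro N
    induction N with
    | zero =>
      intro t ht hta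
      obtain rfl : t = a := le_antisymm (by simpa using hta) ht.1
      simp
    | succ N ih =>
      intro t ht hta
      push_cast at hta
      set r := max a (t - η / 2)
      have har : a ≤ r := le_max_left _ _
      have hrt : r ≤ t := max_le ht.1 (by linarith)
      have hr : r ∈ Icc a b := ⟨har, hrt.trans ht.2⟩
      have hstep := h r hr t ht hrt (by linarith [le_max_right a (t - η / 2)])
      have hrN : r - a ≤ N * (η / 2) :=
        sub_le_iff_le_add.mpr (max_le (by linarith [(by positivity : 0 ≤ N * (η / 2))])
          (by linarith))
      linarith [ih r hr hrN]
  obtain ⟨N, hN⟩ := exists_nat_ge ((b - a) / (η / 2))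
  exact key N b (right_mem_Icc.mpr hab) ((div_le_iff₀ (by positivity)).mp hN)

lemma intervalIntegral_le_mul_of_ae_le {f : ℝ → ℝ} {a b c : ℝ} (hab : a ≤ b)
    (hf : IntervalIntegrable f volume a b) (h : ∀ᵐ r, r ∈ Ioc a b → f r ≤ c) :
    ∫ r in a..b, f r ≤ c * (b - a) := by
  rw [intervalIntegral.integral_of_le hab]
  calc ∫ r in Ioc a b, f r ≤ ∫ _ in Ioc a b, c :=
        setIntegral_mono_on_ae hf.1 (integrable_const c) measurableSet_Ioc h
    _ = c * (b - a) := by simp [hab, mul_comm]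

lemma intervalIntegral_eq_sub_of_lipschitzOnWith {F : Type*} [NormedAddCommGroup F]
    [NormedSpace ℝ F] [CompleteSpace F] {Y d : ℝ → F} {a b : ℝ} {C : NNReal} (hab : a ≤ b)
    (hY : LipschitzOnWith C Y (Icc a b)) (hd : ∀ᵐ t, t ∈ Ioo a b → HasDerivAt Y (d t) t)
    (hint : IntervalIntegrable d volume a b) : ∫ t in a..b, d t = Y b - Y a := by
  -- Continuous functionals reduce the claim to absolutely continuous real functions.
  refine (SeparatingDual.eq_iff_forall_dual_eq (R := ℝ)).mpr fun L => ?_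
  have hLY : LipschitzOnWith (‖L‖₊ * C) (L ∘ Y) (uIcc a b) := by
    rw [uIcc_of_le hab]
    exact L.lipschitz.comp_lipschitzOnWith hY
  rw [← L.intervalIntegral_comp_comm hint, map_sub]
  refine Eq.trans (intervalIntegral.integral_congr_ae ?_)
    hLY.absolutelyContinuousOnInterval.integral_deriv_eq_sub
  filter_upwards [hd, Measure.ae_ne volume b] with t ht htb hmem
  rw [uIoc_of_le hab] at hmem
  exact (L.hasFDerivAt.comp_hasDerivAt t (ht ⟨hmem.1, hmem.2.lt_of_ne htb⟩)).deriv.symm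

section MeasurableSelection

variable {T : Type*} [MeasurableSpace T]

lemma measurable_iInf_of_continuous {Y : Type*} [TopologicalSpace Y]
    [TopologicalSpace.SeparableSpace Y] {g : T → Y → ℝ} (hgc : ∀ t, Continuous (g t))
    (hgm : ∀ y, Measurable fun t => g t y) : Measurable fun t => ⨅ y, g t y := by
  obtain ⟨D, hDc, hDd⟩ := TopologicalSpace.exists_countable_dense Y
  have := hDc.to_subtype
  simp_rw [← hDd.ciInf' (hgc _)]
  exact Measurable.iInf fun d => hgm d

lemma exists_measurable_isMin_real {C : Set ℝ} (hC : IsCompact C) (hne : C.Nonempty)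
    {g : T → C → ℝ} (hgc : ∀ t, Continuous (g t)) (hgm : ∀ c, Measurable fun t => g t c) :
    ∃ c : T → C, Measurable c ∧ ∀ t d, g t (c t) ≤ g t d := by
  have := isCompact_iff_compactSpace.mp hC
  have := hne.to_subtype
  have hbdd : ∀ t, BddBelow (range (g t)) := fun t => (isCompact_range (hgc t)).bddBelow
  -- The least minimiser is a measurable choice.
  have hleast : ∀ t, ∃ c, (∀ d, g t c ≤ g t d) ∧ ∀ d, g t d ≤ g t c → (c : ℝ) ≤ d := by
    intro t
    obtain ⟨c₀, -, hc₀⟩ := isCompact_univ.exists_isMinOn univ_nonempty (hgc t).continuousOn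
    have hcl : IsClosed {c | g t c ≤ g t c₀} := isClosed_le (hgc t) continuous_const
    obtain ⟨c, hc, hmin⟩ := hcl.isCompact.exists_isMinOn ⟨c₀, le_refl (g t c₀)⟩
      continuous_subtype_val.continuousOn
    exact ⟨c, fun d => le_trans hc (hc₀ (mem_univ d)), fun d hd => hmin (le_trans hd hc)⟩
  choose c hcmin hcleast using hleast
  refine ⟨c, Measurable.subtype_mk (f := fun t => (c t : ℝ)) (measurable_of_Iic fun a => ?_), hcmin⟩
  let Q := {d : C // (d : ℝ) ≤ a}
  have : CompactSpace Q := isCompact_iff_compactSpace.mp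
    (isClosed_le continuous_subtype_val continuous_const).isCompact
  have hgQ : ∀ t, Continuous fun d : Q => g t d := fun t => (hgc t).comp continuous_subtype_val
  rcases isEmpty_or_nonempty Q with hQ | hQ
  · convert MeasurableSet.empty
    exact eq_empty_of_forall_notMem fun t ht => hQ.false ⟨c t, ht⟩
  convert measurableSet_le (measurable_iInf_of_continuous hgQ fun d => hgm d)
    (measurable_iInf_of_continuous hgc hgm) using 1
  ext t
  refine ⟨fun ht => ?_, fun ht => ?_⟩
  · exact (ciInf_le (isCompact_range (hgQ t)).bddBelow ⟨c t, ht⟩).trans (le_ciInf (hcmin t))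
  · obtain ⟨d, -, hd⟩ := isCompact_univ.exists_isMinOn univ_nonempty (hgQ t).continuousOn
    have hdc : g t d ≤ g t (c t) :=
      (le_ciInf fun d' => hd (mem_univ d')).trans (le_trans ht (ciInf_le (hbdd t) (c t)))
    exact (hcleast t d hdc).trans d.2

lemma exists_measurable_isMinOn {U : Type*} [MetricSpace U] [MeasurableSpace U] [BorelSpace U]
    {K : Set U} (hK : IsCompact K) (hne : K.Nonempty) {g : T → U → ℝ}
    (hgc : ∀ t, ContinuousOn (g t) K) (hgm : ∀ w ∈ K, Measurable fun t => g t w) :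
    ∃ v : T → U, Measurable v ∧ ∀ t, v t ∈ K ∧ IsMinOn (g t) K (v t) := by
  have := isCompact_iff_compactSpace.mp hK
  have := hne.to_subtype
  -- `K` is a continuous image of the Cantor set, where minimisers can be selected by their order.
  obtain ⟨κ, hκ, hκs⟩ := exists_nat_bool_continuous_surjective_of_compact K
  let θ : cantorSet → K := κ ∘ cantorSetHomeomorphNatToBool
  have hθ : Continuous θ := hκ.comp cantorSetHomeomorphNatToBool.continuous
  have hθs : Function.Surjective θ := hκs.comp cantorSetHomeomorphNatToBool.surjective
  obtain ⟨c, hcm, hc⟩ := exists_measurable_isMin_real isCompact_cantorSet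
    ⟨0, zero_mem_cantorSet⟩ (g := fun t c => g t (θ c))
    (fun t => (hgc t).domRestrict.comp hθ) fun c => hgm _ (θ c).2
  refine ⟨fun t => θ (c t), (continuous_subtype_val.comp hθ).measurable.comp hcm,
    fun t => ⟨(θ (c t)).2, fun w hw => ?_⟩⟩
  obtain ⟨d, hd⟩ := hθs ⟨w, hw⟩
  simpa only [hd, mem_ofPred_eq] using hc t d

end MeasurableSelection

/-! ### Extended velocities and pointwise Hamilton–Jacobi inequalities -/

/-- The linear functional `(c, v) ↦ c + ⟨ξ, v⟩` on pairs of a cost rate and a velocity. The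
Hamilton function is its value at the extended velocity. -/
noncomputable def costateFunctional {E : Type*} [NormedAddCommGroup E] [InnerProductSpace ℝ E]
    (ξ : E) : ℝ × E →L[ℝ] ℝ :=
  ContinuousLinearMap.fst ℝ ℝ E + (innerSL ℝ ξ).comp (ContinuousLinearMap.snd ℝ ℝ E)

section Costate

variable {E : Type*} [NormedAddCommGroup E] [InnerProductSpace ℝ E]

lemma abs_costateFunctional_le (ξ : E) (w : ℝ × E) :
    |costateFunctional ξ w| ≤ (1 + ‖ξ‖) * ‖w‖ := by
  calc |w.1 + inner ℝ ξ w.2| ≤ |w.1| + ‖ξ‖ * ‖w.2‖ :=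
        (abs_add_le _ _).trans (by gcongr; exact abs_real_inner_le_norm _ _)
    _ ≤ ‖w‖ + ‖ξ‖ * ‖w‖ := by gcongr; exacts [norm_fst_le w, norm_snd_le w]
    _ = (1 + ‖ξ‖) * ‖w‖ := by ring

end Costate

namespace ControlProblem

variable {n m : ℕ} {P : ControlProblem n m}

/-- The extended velocity `(e^{-δt} l, f)`, whose first entry is the discounted cost rate. -/
noncomputable def velocity (P : ControlProblem n m) (t : ℝ) (x : EuclideanSpace ℝ (Fin n))
    (u : EuclideanSpace ℝ (Fin m)) : ℝ × EuclideanSpace ℝ (Fin n) :=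
  (Real.exp (-P.δ * t) * P.l t x u, P.f t x u)

lemma preHamiltonian_eq (t : ℝ) (x ξ : EuclideanSpace ℝ (Fin n))
    (u : EuclideanSpace ℝ (Fin m)) :
    P.preHamiltonian t x ξ u = costateFunctional ξ (P.velocity t x u) :=
  add_comm _ _

lemma abs_preHamiltonian_sub_le (t t' : ℝ) (x x' ξ : EuclideanSpace ℝ (Fin n))
    (u u' : EuclideanSpace ℝ (Fin m)) :
    |P.preHamiltonian t x ξ u - P.preHamiltonian t' x' ξ u'| ≤
      (1 + ‖ξ‖) * ‖P.velocity t x u - P.velocity t' x' u'‖ := by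
  rw [preHamiltonian_eq, preHamiltonian_eq, ← map_sub]
  exact abs_costateFunctional_le _ _

namespace Standing

lemma continuousOn_velocity (hP : P.Standing) : ContinuousOn
    (fun p : ℝ × EuclideanSpace ℝ (Fin n) × EuclideanSpace ℝ (Fin m) =>
      P.velocity p.1 p.2.1 p.2.2) {p | 0 ≤ p.1} :=
  ((Continuous.continuousOn (by fun_prop)).mul hP.continuous_l).prodMk hP.continuous_f

lemma continuous_velocity (hP : P.Standing) {t : ℝ} (ht : 0 ≤ t)
    (x : EuclideanSpace ℝ (Fin n)) : Continuous (P.velocity t x) :=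
  continuousOn_univ.mp <| hP.continuousOn_velocity.comp
    (f := fun u : EuclideanSpace ℝ (Fin m) => (t, x, u)) (Continuous.continuousOn (by fun_prop))
    fun _ _ => ht

lemma continuous_preHamiltonian (hP : P.Standing) {t : ℝ} (ht : 0 ≤ t)
    (x ξ : EuclideanSpace ℝ (Fin n)) : Continuous (P.preHamiltonian t x ξ) := by
  simp only [funext (preHamiltonian_eq (P := P) t x ξ)]
  exact (costateFunctional ξ).continuous.comp (hP.continuous_velocity ht x)

lemma exp_neg_discount_le_one (hP : P.Standing) {t : ℝ} (ht : 0 ≤ t) :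
    Real.exp (-P.δ * t) ≤ 1 :=
  Real.exp_le_one_iff.mpr (by nlinarith [hP.discount_pos])

lemma exists_norm_velocity_le (hP : P.Standing) : ∃ K : ℝ, 0 < K ∧ ∀ t : ℝ, 0 ≤ t →
    ∀ x : EuclideanSpace ℝ (Fin n), ∀ u ∈ P.Ω, ‖P.velocity t x u‖ ≤ K * (1 + ‖x‖) := by
  obtain ⟨K, hK, h⟩ := hP.growth
  refine ⟨K, hK, fun t ht x u hu => max_le ?_ ?_⟩
  · calc |Real.exp (-P.δ * t) * P.l t x u| ≤ |P.l t x u| := by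
          rw [abs_mul, Real.abs_exp]
          exact mul_le_of_le_one_left (abs_nonneg _) (hP.exp_neg_discount_le_one ht)
      _ ≤ K * (1 + ‖x‖) := by linarith [h t ht x u hu, norm_nonneg (P.f t x u)]
  · exact (le_add_of_nonneg_left (abs_nonneg _)).trans (h t ht x u hu)

lemma exists_norm_velocity_sub_le (hP : P.Standing) : ∃ K : ℝ, 0 < K ∧ ∀ t : ℝ, 0 ≤ t →
    ∀ x z : EuclideanSpace ℝ (Fin n), ∀ u ∈ P.Ω,
      ‖P.velocity t x u - P.velocity t z u‖ ≤ K * ‖x - z‖ := by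
  obtain ⟨K, hK, h⟩ := hP.lipschitz
  refine ⟨K, hK, fun t ht x z u hu => max_le ?_ ?_⟩
  · calc |Real.exp (-P.δ * t) * P.l t x u - Real.exp (-P.δ * t) * P.l t z u|
        ≤ |P.l t x u - P.l t z u| := by
          rw [← mul_sub, abs_mul, Real.abs_exp]
          exact mul_le_of_le_one_left (abs_nonneg _) (hP.exp_neg_discount_le_one ht)
      _ ≤ K * ‖x - z‖ := by linarith [h t ht u hu x z, norm_nonneg (P.f t x u - P.f t z u)]
  · exact (le_add_of_nonneg_left (abs_nonneg _)).trans (h t ht u hu x z)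

lemma exists_velocity_modulus (hP : P.Standing) (T R : ℝ) {ε : ℝ} (hε : 0 < ε) :
    ∃ η : ℝ, 0 < η ∧ ∀ t ∈ Icc 0 T, ∀ t' ∈ Icc 0 T, ∀ x x' : EuclideanSpace ℝ (Fin n),
      ‖x‖ ≤ R → ‖x'‖ ≤ R → |t - t'| < η → ‖x - x'‖ < η → ∀ u ∈ P.Ω,
        ‖P.velocity t x u - P.velocity t' x' u‖ ≤ ε := by
  have hK : IsCompact (Icc 0 T ×ˢ
      (Metric.closedBall (0 : EuclideanSpace ℝ (Fin n)) R ×ˢ P.Ω)) :=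
    isCompact_Icc.prod ((isCompact_closedBall _ _).prod hP.compact_controls)
  obtain ⟨η, hη, h⟩ := Metric.uniformContinuousOn_iff.mp (hK.uniformContinuousOn_of_continuous
    (hP.continuousOn_velocity.mono fun p hp => hp.1.1)) ε hε
  refine ⟨η, hη, fun t ht t' ht' x x' hx hx' htt hxx u hu => ?_⟩
  rw [← dist_eq_norm]
  refine (h (t, x, u) ⟨ht, by simpa using hx, hu⟩ (t', x', u) ⟨ht', by simpa using hx', hu⟩ ?_).le
  rw [Prod.dist_eq, Prod.dist_eq, dist_self, Real.dist_eq, dist_eq_norm]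
  exact max_lt htt (max_lt hxx hη)

lemma isCompact_image_preHamiltonian (hP : P.Standing) {t : ℝ} (ht : 0 ≤ t)
    (x ξ : EuclideanSpace ℝ (Fin n)) : IsCompact (P.preHamiltonian t x ξ '' P.Ω) :=
  hP.compact_controls.image (hP.continuous_preHamiltonian ht x ξ)

section HJB

variable {φ : ℝ → EuclideanSpace ℝ (Fin n) → ℝ} {s : ℝ} {z : EuclideanSpace ℝ (Fin n)}

lemma supMaxHJB_nonpos_iff (hP : P.Standing) (hs : 0 ≤ s) : P.supMaxHJB φ s z ≤ 0 ↔
    ∀ p ∈ proximalSubgradient φ s z, ∀ v ∈ P.Ω, p.1 + P.preHamiltonian s z p.2 v ≤ 0 := by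
  simp only [supMaxHJB, iSup₂_le_iff, EReal.coe_nonpos, ← le_neg_iff_add_nonpos_left]
  refine forall₂_congr fun p _ => ?_
  rw [maxHamiltonian, csSup_le_iff (hP.isCompact_image_preHamiltonian hs _ _).bddAbove
    (hP.controls_nonempty.image _), forall_mem_image]

lemma infHJB_nonneg_iff (hP : P.Standing) (hs : 0 ≤ s) : 0 ≤ P.infHJB φ s z ↔
    ∀ p ∈ proximalSubgradient φ s z, ∀ v ∈ P.Ω, 0 ≤ p.1 + P.preHamiltonian s z p.2 v := by
  simp only [infHJB, le_iInf₂_iff, EReal.coe_nonneg, ← neg_le_iff_add_nonneg']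
  refine forall₂_congr fun p _ => ?_
  rw [hamiltonian, le_csInf_iff (hP.isCompact_image_preHamiltonian hs _ _).bddBelow
    (hP.controls_nonempty.image _), forall_mem_image]

lemma supHJB_nonpos_iff (hP : P.Standing) (hs : 0 ≤ s) : P.supHJB φ s z ≤ 0 ↔
    ∀ p ∈ proximalSubgradient φ s z, ∃ v ∈ P.Ω, p.1 + P.preHamiltonian s z p.2 v ≤ 0 := by
  simp only [supHJB, iSup₂_le_iff, EReal.coe_nonpos]
  refine forall₂_congr fun p _ => ⟨fun h => ?_, fun ⟨v, hv, h⟩ => ?_⟩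
  · obtain ⟨v, hv, hmin⟩ := (hP.isCompact_image_preHamiltonian hs z p.2).sInf_mem
      (hP.controls_nonempty.image _)
    exact ⟨v, hv, hmin.symm ▸ h⟩
  · exact (add_le_add_right (csInf_le (hP.isCompact_image_preHamiltonian hs z p.2).bddBelow
      (mem_image_of_mem _ hv)) _).trans h

end HJB

end Standing

end ControlProblem

/-! ### Regularization by inf-convolution -/

section InfConvolution

variable {E : Type*} [NormedAddCommGroup E]

/-- The function of `q` minimised in the quadratic inf-convolution of `φ` at `(t, x)`, with weight
`ρ` in time and weight `σ` in space. -/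
noncomputable def quadraticPenalization (φ : ℝ → E → ℝ) (ρ σ t : ℝ) (x : E) (q : ℝ × E) : ℝ :=
  φ q.1 q.2 + (ρ * (t - q.1) ^ 2 + σ * ‖x - q.2‖ ^ 2)

/-- The quadratic inf-convolution of `φ` over `K`, with weights `ρ` in time and `σ` in space. -/
noncomputable def infConvolution (φ : ℝ → E → ℝ) (K : Set (ℝ × E)) (ρ σ t : ℝ) (x : E) : ℝ :=
  sInf (quadraticPenalization φ ρ σ t x '' K)

variable {φ : ℝ → E → ℝ} {K : Set (ℝ × E)} {ρ σ t : ℝ} {x : E} {q : ℝ × E}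

lemma continuousOn_quadraticPenalization (hφ : ContinuousOn (Function.uncurry φ) K) (ρ σ t : ℝ)
    (x : E) : ContinuousOn (quadraticPenalization φ ρ σ t x) K :=
  hφ.add (Continuous.continuousOn (by fun_prop))

lemma infConvolution_le (hK : IsCompact K) (hφ : ContinuousOn (Function.uncurry φ) K)
    (hq : q ∈ K) : infConvolution φ K ρ σ t x ≤ quadraticPenalization φ ρ σ t x q :=
  csInf_le (hK.image_of_continuousOn (continuousOn_quadraticPenalization hφ ρ σ t x)).bddBelow
    (mem_image_of_mem _ hq)

lemma infConvolution_eq (hq : q ∈ K) (hmin : IsMinOn (quadraticPenalization φ ρ σ t x) K q) :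
    infConvolution φ K ρ σ t x = quadraticPenalization φ ρ σ t x q :=
  IsLeast.csInf_eq ⟨mem_image_of_mem _ hq, forall_mem_image.mpr fun _ hq' => hmin hq'⟩

lemma penalty_le_of_isMinOn (hmin : IsMinOn (quadraticPenalization φ ρ σ t x) K q)
    (htx : (t, x) ∈ K) :
    ρ * (t - q.1) ^ 2 + σ * ‖x - q.2‖ ^ 2 ≤ φ t x - φ q.1 q.2 := by
  have h : quadraticPenalization φ ρ σ t x q ≤ quadraticPenalization φ ρ σ t x (t, x) := hmin htx
  simp only [quadraticPenalization, sub_self, norm_zero] at h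
  linarith

lemma abs_infConvolution_sub_le (hρ : 0 ≤ ρ) (hσ : 0 ≤ σ) (hq : q ∈ K)
    (hmin : IsMinOn (quadraticPenalization φ ρ σ t x) K q) (htx : (t, x) ∈ K) :
    |infConvolution φ K ρ σ t x - φ t x| ≤ |φ t x - φ q.1 q.2| := by
  have hloc := penalty_le_of_isMinOn hmin htx
  have hpos : 0 ≤ ρ * (t - q.1) ^ 2 + σ * ‖x - q.2‖ ^ 2 := by positivity
  rw [infConvolution_eq hq hmin, quadraticPenalization, abs_of_nonneg (hpos.trans hloc), abs_le]
  constructor <;> linarith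

lemma exists_weight_forall_isMinOn_near (hK : IsCompact K)
    (hφ : ContinuousOn (Function.uncurry φ) K) {η : ℝ} (hη : 0 < η) :
    ∃ w : ℝ, 0 < w ∧ ∀ ρ σ t : ℝ, 0 ≤ ρ → 0 ≤ σ → ∀ x, (t, x) ∈ K → ∀ q ∈ K,
      IsMinOn (quadraticPenalization φ ρ σ t x) K q →
      (w ≤ ρ → |t - q.1| < η) ∧ (w ≤ σ → ‖x - q.2‖ < η) := by
  obtain ⟨M, hM⟩ := hK.exists_bound_of_continuousOn hφ
  obtain ⟨w, hw, hwη⟩ := exists_pos_forall_mul_sq_le_imp_lt (2 * M) hη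
  refine ⟨w, hw, fun ρ σ t hρ hσ x htx q hq hmin => ?_⟩
  have hosc : ρ * (t - q.1) ^ 2 + σ * ‖x - q.2‖ ^ 2 ≤ 2 * M := by
    have htxM : |φ t x| ≤ M := hM _ htx
    have hqM : |φ q.1 q.2| ≤ M := hM _ hq
    linarith [penalty_le_of_isMinOn hmin htx, abs_le.mp htxM, abs_le.mp hqM]
  refine ⟨fun h => hwη _ ?_, fun h => abs_norm (x - q.2) ▸ hwη _ ?_⟩
  · linarith [mul_le_mul_of_nonneg_right h (sq_nonneg (t - q.1)),
      mul_nonneg hσ (sq_nonneg ‖x - q.2‖)]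
  · linarith [mul_le_mul_of_nonneg_right h (sq_nonneg ‖x - q.2‖),
      mul_nonneg hρ (sq_nonneg (t - q.1))]

/-- `p` is a proximal supergradient of `V` at `(t, x)`, with constant `C` and without restriction
to a neighbourhood. -/
def IsProximalSupergradient [InnerProductSpace ℝ E] (V : ℝ → E → ℝ) (C t : ℝ) (x : E)
    (p : ℝ × E) : Prop :=
  ∀ t' x', V t' x' ≤
    V t x + p.1 * (t' - t) + inner ℝ p.2 (x' - x) + C * (|t' - t| ^ 2 + ‖x' - x‖ ^ 2)

lemma isProximalSupergradient_infConvolution [InnerProductSpace ℝ E] (hK : IsCompact K)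
    (hφ : ContinuousOn (Function.uncurry φ) K) {C : ℝ} (hρ : ρ ≤ C) (hσ : σ ≤ C) (hq : q ∈ K)
    (hmin : IsMinOn (quadraticPenalization φ ρ σ t x) K q) :
    IsProximalSupergradient (infConvolution φ K ρ σ) C t x
      (2 * ρ * (t - q.1), (2 * σ) • (x - q.2)) := by
  intro t' x'
  have hle : infConvolution φ K ρ σ t' x' ≤ quadraticPenalization φ ρ σ t' x' q :=
    infConvolution_le hK hφ hq
  have hexp : ‖x' - q.2‖ ^ 2 =
      ‖x - q.2‖ ^ 2 + 2 * inner ℝ (x - q.2) (x' - x) + ‖x' - x‖ ^ 2 := by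
    rw [← norm_add_sq_real]; congr 2; abel
  rw [infConvolution_eq hq hmin, real_inner_smul_left, sq_abs]
  simp only [quadraticPenalization, hexp] at hle ⊢
  linarith [mul_le_mul_of_nonneg_right hρ (sq_nonneg (t' - t)),
    mul_le_mul_of_nonneg_right hσ (sq_nonneg ‖x' - x‖)]

end InfConvolution

lemma mem_proximalSubgradient_of_isMinOn {n : ℕ} {φ : ℝ → EuclideanSpace ℝ (Fin n) → ℝ}
    {K : Set (ℝ × EuclideanSpace ℝ (Fin n))} {ρ σ t : ℝ} {x : EuclideanSpace ℝ (Fin n)}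
    {q : ℝ × EuclideanSpace ℝ (Fin n)} (hρ : 0 < ρ) (hσ : 0 < σ)
    (hmin : IsMinOn (quadraticPenalization φ ρ σ t x) K q) (hK : K ∈ 𝓝[{q | 0 ≤ q.1}] q) :
    (2 * ρ * (t - q.1), (2 * σ) • (x - q.2)) ∈ proximalSubgradient φ q.1 q.2 := by
  refine ⟨ρ + σ, by positivity, ?_⟩
  filter_upwards [hK] with q' hq'
  have h : quadraticPenalization φ ρ σ t x q ≤ quadraticPenalization φ ρ σ t x q' := hmin hq'
  have hexp : ‖x - q'.2‖ ^ 2 =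
      ‖x - q.2‖ ^ 2 - 2 * inner ℝ (x - q.2) (q'.2 - q.2) + ‖q'.2 - q.2‖ ^ 2 := by
    rw [← norm_sub_sq_real]; congr 2; abel
  rw [sq_abs, real_inner_smul_left]
  simp only [quadraticPenalization, hexp] at h
  linarith [mul_nonneg hσ.le (sq_nonneg (q'.1 - q.1)),
    mul_nonneg hρ.le (sq_nonneg ‖q'.2 - q.2‖)]

namespace ControlProblem

variable {n m : ℕ} {P : ControlProblem n m}

/-- On `[0, T] × B(0, R)` the function `V` is uniformly `ε`-close to `φ` and has proximal
supergradients which are proximal subgradients of `φ` at nearby points, with values of the Hamilton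
function close enough for the Hamilton-Jacobi inequalities to be transferred from `φ` to `V`. -/
structure IsRegularization (P : ControlProblem n m) (φ V : ℝ → EuclideanSpace ℝ (Fin n) → ℝ)
    (T R C ε : ℝ) : Prop where
  abs_sub_le : ∀ t ∈ Icc 0 T, ∀ x, ‖x‖ ≤ R → |V t x - φ t x| ≤ ε
  exists_supergradient : ∀ t ∈ Icc 0 T, ∀ x, ‖x‖ ≤ R →
    ∃ τ y, ∃ p ∈ proximalSubgradient φ τ y, 0 ≤ τ ∧ |t - τ| < ε ∧ ‖p.2‖ ≤ C ∧
      (∀ u ∈ P.Ω, |P.preHamiltonian t x p.2 u - P.preHamiltonian τ y p.2 u| ≤ ε) ∧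
      IsProximalSupergradient V C t x p

lemma abs_preHamiltonian_sub_le_of_penalty_le {K σ ω η ε t τ : ℝ}
    {x y : EuclideanSpace ℝ (Fin n)} {u : EuclideanSpace ℝ (Fin m)} (hK : 0 < K) (hσ : 0 < σ)
    (hω : (1 + 2 * σ) * ω ≤ ε / 3) (hη : K * η ≤ ε / 3) (hη1 : η ≤ 1) (hxy : ‖x - y‖ ≤ η)
    (hpen : σ * ‖x - y‖ ^ 2 ≤ ε / (6 * K))
    (htime : ‖P.velocity t x u - P.velocity τ x u‖ ≤ ω)
    (hspace : ‖P.velocity τ x u - P.velocity τ y u‖ ≤ K * ‖x - y‖) :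
    |P.preHamiltonian t x ((2 * σ) • (x - y)) u - P.preHamiltonian τ y ((2 * σ) • (x - y)) u|
      ≤ ε := by
  have hω0 : 0 ≤ ω := (norm_nonneg _).trans htime
  have hpen' : 2 * K * (σ * ‖x - y‖ ^ 2) ≤ ε / 3 := by
    calc 2 * K * (σ * ‖x - y‖ ^ 2) ≤ 2 * K * (ε / (6 * K)) := by gcongr
      _ = ε / 3 := by field_simp; ring
  calc |P.preHamiltonian t x ((2 * σ) • (x - y)) u - P.preHamiltonian τ y ((2 * σ) • (x - y)) u|
      ≤ (1 + 2 * σ * ‖x - y‖) * ‖P.velocity t x u - P.velocity τ y u‖ := by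
        refine (abs_preHamiltonian_sub_le ..).trans_eq ?_
        rw [norm_smul, Real.norm_of_nonneg (by positivity)]
    _ ≤ (1 + 2 * σ * ‖x - y‖) * (ω + K * ‖x - y‖) := by
        gcongr
        exact (norm_sub_le_norm_sub_add_norm_sub _ _ _).trans (add_le_add htime hspace)
    _ = (1 + 2 * σ * ‖x - y‖) * ω + K * ‖x - y‖ + 2 * K * (σ * ‖x - y‖ ^ 2) := by ring
    _ ≤ (1 + 2 * σ * 1) * ω + K * η + ε / 3 := by
        gcongr
        exact hxy.trans hη1
    _ ≤ ε := by linarith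

lemma Icc_prod_closedBall_mem_nhdsWithin {E : Type*} [NormedAddCommGroup E] {T R τ : ℝ} {y : E}
    (hτ : τ < T) (hy : ‖y‖ < R) :
    Icc 0 T ×ˢ Metric.closedBall 0 R ∈ 𝓝[{q : ℝ × E | 0 ≤ q.1}] (τ, y) := by
  filter_upwards [self_mem_nhdsWithin, nhdsWithin_le_nhds <|
    prod_mem_nhds (Iio_mem_nhds hτ) (Metric.isOpen_ball.mem_nhds (mem_ball_zero_iff.mpr hy))]
    with q hq0 hq
  exact ⟨⟨hq0, le_of_lt hq.1⟩, Metric.ball_subset_closedBall hq.2⟩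

/-- The weight in space is chosen first, so that the term `σ ‖x - y‖²` and the Lipschitz constant
in `x` control the spatial part of the error; the weight in time then has to be large compared to
the norm of the costate, as the data is merely continuous in time. -/
lemma Standing.exists_weights (hP : P.Standing) {φ : ℝ → EuclideanSpace ℝ (Fin n) → ℝ} {T R : ℝ}
    (hφ : ContinuousOn (Function.uncurry φ) (Icc 0 T ×ˢ Metric.closedBall 0 R)) {ε : ℝ}
    (hε : 0 < ε) :
    ∃ ρ σ : ℝ, 0 < ρ ∧ 0 < σ ∧ ∀ t x, (t, x) ∈ Icc 0 T ×ˢ Metric.closedBall 0 R →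
      ∀ τ y, (τ, y) ∈ Icc 0 T ×ˢ Metric.closedBall 0 R →
      IsMinOn (quadraticPenalization φ ρ σ t x) (Icc 0 T ×ˢ Metric.closedBall 0 R) (τ, y) →
      |t - τ| < min ε 1 ∧ ‖x - y‖ < 1 ∧ |φ t x - φ τ y| ≤ ε ∧ ∀ u ∈ P.Ω,
        |P.preHamiltonian t x ((2 * σ) • (x - y)) u - P.preHamiltonian τ y ((2 * σ) • (x - y)) u|
          ≤ ε := by
  have hK : IsCompact (Icc (0 : ℝ) T ×ˢ Metric.closedBall (0 : EuclideanSpace ℝ (Fin n)) R) :=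
    isCompact_Icc.prod (isCompact_closedBall _ _)
  obtain ⟨L, hL, hLip⟩ := hP.exists_norm_velocity_sub_le
  obtain ⟨η₀, hη₀, hmodφ⟩ := Metric.uniformContinuousOn_iff.mp
    (hK.uniformContinuousOn_of_continuous hφ) (min ε (ε / (6 * L))) (by positivity)
  obtain ⟨η, hη, hη0, hηL, hη1⟩ : ∃ η > 0, η ≤ η₀ ∧ η ≤ ε / (3 * L) ∧ η ≤ 1 :=
    ⟨min η₀ (min (ε / (3 * L)) 1), by positivity, by simp, by simp, by simp⟩
  obtain ⟨σ, hσ, hση⟩ := exists_weight_forall_isMinOn_near hK hφ hη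
  obtain ⟨η₁, hη₁, hmodt⟩ := hP.exists_velocity_modulus T R
    (ε := ε / (3 * (1 + 2 * σ))) (by positivity)
  obtain ⟨ρ, hρ, hρθ⟩ :=
    exists_weight_forall_isMinOn_near hK hφ (η := min η (min η₁ ε)) (by positivity)
  refine ⟨ρ, σ, hρ, hσ, fun t x htx τ y hq hmin => ?_⟩
  have hxy : ‖x - y‖ < η := (hση ρ σ t hρ.le hσ.le x htx _ hq hmin).2 le_rfl
  obtain ⟨htη, htη₁, htε⟩ : |t - τ| < η ∧ |t - τ| < η₁ ∧ |t - τ| < ε := by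
    simpa only [lt_min_iff] using (hρθ ρ σ t hρ.le hσ.le x htx _ hq hmin).1 le_rfl
  obtain ⟨hoscε, hoscL⟩ : |φ t x - φ τ y| < ε ∧ |φ t x - φ τ y| < ε / (6 * L) := by
    refine lt_min_iff.mp (hmodφ (t, x) htx (τ, y) hq ?_)
    rw [Prod.dist_eq, Real.dist_eq, dist_eq_norm]
    exact max_lt (htη.trans_le hη0) (hxy.trans_le hη0)
  refine ⟨lt_min htε (htη.trans_le hη1), hxy.trans_le hη1, hoscε.le, fun u hu => ?_⟩
  have hpen : σ * ‖x - y‖ ^ 2 ≤ ε / (6 * L) := by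
    linarith [penalty_le_of_isMinOn hmin htx, mul_nonneg hρ.le (sq_nonneg (t - τ)),
      le_abs_self (φ t x - φ τ y)]
  exact abs_preHamiltonian_sub_le_of_penalty_le hL hσ (by field_simp; rfl)
    (by rw [le_div_iff₀ (by positivity)] at hηL; linarith) hη1 hxy.le hpen
    (hmodt t htx.1 τ hq.1 x x (by simpa using htx.2) (by simpa using htx.2) htη₁ (by simpa) u hu)
    (hLip τ hq.1.1 x y u hu)

lemma Standing.exists_isRegularization (hP : P.Standing)
    {φ : ℝ → EuclideanSpace ℝ (Fin n) → ℝ}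
    (hφ : ContinuousOn (Function.uncurry φ) {q | 0 ≤ q.1}) (T R : ℝ) {ε : ℝ} (hε : 0 < ε) :
    ∃ V C, P.IsRegularization φ V T R C ε := by
  let K : Set (ℝ × EuclideanSpace ℝ (Fin n)) := Icc 0 (T + 1) ×ˢ Metric.closedBall 0 (R + 1)
  have hK : IsCompact K := isCompact_Icc.prod (isCompact_closedBall _ _)
  have hφK : ContinuousOn (Function.uncurry φ) K := hφ.mono fun q hq => hq.1.1
  have hKmem : ∀ t ∈ Icc 0 T, ∀ x, ‖x‖ ≤ R → (t, x) ∈ K := fun t ht x hx =>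
    ⟨⟨ht.1, by linarith [ht.2]⟩, by simp; linarith⟩
  obtain ⟨ρ, σ, hρ, hσ, hclose⟩ := hP.exists_weights hφK hε
  have hex : ∀ t x, (t, x) ∈ K → ∃ q ∈ K, IsMinOn (quadraticPenalization φ ρ σ t x) K q :=
    fun t x htx => hK.exists_isMinOn ⟨_, htx⟩ (continuousOn_quadraticPenalization hφK ρ σ t x)
  refine ⟨infConvolution φ K ρ σ, 2 * σ + ρ, fun t ht x hx => ?_, fun t ht x hx => ?_⟩
  · obtain ⟨⟨τ, y⟩, hq, hmin⟩ := hex t x (hKmem t ht x hx)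
    exact (abs_infConvolution_sub_le hρ.le hσ.le hq hmin (hKmem t ht x hx)).trans
      (hclose t x (hKmem t ht x hx) τ y hq hmin).2.2.1
  · obtain ⟨⟨τ, y⟩, hq, hmin⟩ := hex t x (hKmem t ht x hx)
    obtain ⟨htτ, hxy, -, hham⟩ := hclose t x (hKmem t ht x hx) τ y hq hmin
    obtain ⟨htε, ht1⟩ := lt_min_iff.mp htτ
    have hnhds : K ∈ 𝓝[{q | 0 ≤ q.1}] (τ, y) := Icc_prod_closedBall_mem_nhdsWithin
      (by linarith [abs_lt.mp ht1, ht.2]) (by linarith [norm_le_norm_add_norm_sub x y])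
    refine ⟨τ, y, _, mem_proximalSubgradient_of_isMinOn hρ hσ hmin hnhds, hq.1.1, htε, ?_, hham,
      isProximalSupergradient_infConvolution hK hφK (by linarith) (by linarith) hq hmin⟩
    simp only [norm_smul, Real.norm_of_nonneg (by positivity : 0 ≤ 2 * σ)]
    linarith [mul_le_mul_of_nonneg_left hxy.le hσ.le]

end ControlProblem

/-! ### Monotonicity along processes -/

lemma exists_forall_mul_sq_add_sq_le (B C : ℝ) {ε : ℝ} (hε : 0 < ε) :
    ∃ η : ℝ, 0 < η ∧ ∀ d e : ℝ, |d| < η → |e| ≤ B * |d| → C * (|d| ^ 2 + e ^ 2) ≤ ε * |d| := by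
  have hpos : 0 < |C| * (1 + B ^ 2) + 1 := by positivity
  refine ⟨ε / (|C| * (1 + B ^ 2) + 1), by positivity, fun d e hd he => ?_⟩
  calc C * (|d| ^ 2 + e ^ 2) ≤ |C| * (|d| ^ 2 + (B * |d|) ^ 2) := by
        rw [← sq_abs e]
        gcongr
        exact le_abs_self C
    _ = |C| * (1 + B ^ 2) * |d| * |d| := by ring
    _ ≤ ε * |d| := by
        gcongr
        linarith [(lt_div_iff₀ hpos).mp hd, abs_nonneg d]

lemma intervalIntegrable_of_locallyIntegrableOn_Ici {E : Type*} [NormedAddCommGroup E]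
    {g : ℝ → E} {s a b : ℝ} (hg : LocallyIntegrableOn g (Ici s)) (ha : s ≤ a) (hb : s ≤ b) :
    IntervalIntegrable g volume a b :=
  (hg.integrableOn_compact_subset (fun _ hr => (le_inf ha hb).trans hr.1)
    isCompact_uIcc).intervalIntegrable

namespace ControlProblem

variable {n m : ℕ} {P : ControlProblem n m} {s : ℝ} {z : EuclideanSpace ℝ (Fin n)}
  {x : ℝ → EuclideanSpace ℝ (Fin n)} {u : ℝ → EuclideanSpace ℝ (Fin m)}

namespace IsAdmissible

lemma intervalIntegrable_velocity (h : P.IsAdmissible s z x u) {a b : ℝ} (ha : s ≤ a)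
    (hb : s ≤ b) : IntervalIntegrable (fun r => P.f r (x r) (u r)) volume a b :=
  intervalIntegrable_of_locallyIntegrableOn_Ici h.velocity_locallyIntegrable ha hb

lemma state_sub (h : P.IsAdmissible s z x u) {a b : ℝ} (ha : s ≤ a) (hb : s ≤ b) :
    x b - x a = ∫ r in a..b, P.f r (x r) (u r) := by
  rw [h.state_eq a ha, h.state_eq b hb, ← intervalIntegral.integral_interval_sub_left
    (h.intervalIntegrable_velocity le_rfl hb) (h.intervalIntegrable_velocity le_rfl ha)]
  abel

lemma ae_control_mem (h : P.IsAdmissible s z x u) : ∀ᵐ r, s ≤ r → u r ∈ P.Ω :=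
  (ae_restrict_iff' measurableSet_Ici).mp h.control_mem

lemma continuousOn_state (h : P.IsAdmissible s z x u) (b : ℝ) : ContinuousOn x (Icc s b) := by
  rcases lt_or_ge b s with hb | hb
  · simp [Icc_eq_empty_of_lt hb]
  have hprim := intervalIntegral.continuousOn_primitive_interval (μ := volume)
    (h.velocity_locallyIntegrable.integrableOn_compact_subset
      (by rw [uIcc_of_le hb]; exact Icc_subset_Ici_self) (isCompact_uIcc (a := s) (b := b)))
  rw [uIcc_of_le hb] at hprim
  exact (continuousOn_const.add hprim).congr fun t ht => h.state_eq t ht.1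

lemma exists_norm_state_sub_le (hP : P.Standing) (hs : 0 ≤ s) (h : P.IsAdmissible s z x u)
    (b : ℝ) : ∃ B : ℝ, ∀ t ∈ Icc s b, ∀ t' ∈ Icc s b, ‖x t' - x t‖ ≤ B * |t' - t| := by
  obtain ⟨R, hR⟩ := isCompact_Icc.exists_bound_of_continuousOn (h.continuousOn_state b)
  obtain ⟨K, hK, hgrowth⟩ := hP.exists_norm_velocity_le
  refine ⟨K * (1 + R), fun t ht t' ht' => ?_⟩
  rw [h.state_sub ht.1 ht'.1]
  refine intervalIntegral.norm_integral_le_of_norm_le_const_ae ?_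
  filter_upwards [h.ae_control_mem] with r hr hrt
  have hrI : r ∈ Icc s b := uIcc_subset_Icc ht ht' (uIoc_subset_uIcc hrt)
  calc ‖P.f r (x r) (u r)‖ ≤ ‖P.velocity r (x r) (u r)‖ := norm_snd_le (P.velocity r (x r) (u r))
    _ ≤ K * (1 + ‖x r‖) := hgrowth r (hs.trans hrI.1) (x r) (u r) (hr hrI.1)
    _ ≤ K * (1 + R) := by gcongr; exact hR r hrI

end IsAdmissible

lemma intervalIntegrable_discountedCost
    (h : IntegrableOn (P.discountedCost x u) (Ioi s)) {a b : ℝ} (ha : s ≤ a) (hb : s ≤ b) :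
    IntervalIntegrable (P.discountedCost x u) volume a b := by
  rw [intervalIntegrable_iff]
  exact h.mono_set fun r hr => (le_inf ha hb).trans_lt hr.1

lemma pathValue_sub (φ : ℝ → EuclideanSpace ℝ (Fin n) → ℝ)
    (h : IntegrableOn (P.discountedCost x u) (Ioi s)) {a b : ℝ} (ha : s ≤ a) (hb : s ≤ b) :
    P.pathValue φ x u b - P.pathValue φ x u a =
      φ b (x b) - φ a (x a) + ∫ r in a..b, P.discountedCost x u r := by
  have hcost := intervalIntegral.integral_interval_add_Ioi (a := a) (b := b)
    (h.mono_set (Ioi_subset_Ioi ha)) (h.mono_set (Ioi_subset_Ioi hb))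
  unfold pathValue
  linarith

lemma continuousOn_pathValue {φ : ℝ → EuclideanSpace ℝ (Fin n) → ℝ}
    (hφ : ContinuousOn (Function.uncurry φ) {q | 0 ≤ q.1}) (hs : 0 ≤ s)
    (hx : ∀ b, ContinuousOn x (Icc s b))
    (hcost : IntegrableOn (P.discountedCost x u) (Ioi s)) {b : ℝ} (hb : s ≤ b) :
    ContinuousOn (P.pathValue φ x u) (Icc s b) := by
  have hφx : ContinuousOn (fun t => φ t (x t)) (Icc s b) :=
    hφ.comp (continuousOn_id.prodMk (hx b)) fun t ht => hs.trans ht.1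
  have hprim := intervalIntegral.continuousOn_primitive_interval (μ := volume) (a := s) (b := b)
    (f := P.discountedCost x u)
    (by
      rw [uIcc_of_le hb, integrableOn_Icc_iff_integrableOn_Ioc]
      exact hcost.mono_set Ioc_subset_Ioi_self)
  rw [uIcc_of_le hb] at hprim
  refine ((hφx.add hprim).add (continuousOn_const (c := P.pathValue φ x u s - φ s (x s)))).congr
    fun t ht => ?_
  simp only [Pi.add_apply]
  linarith [pathValue_sub φ hcost le_rfl ht.1]

lemma IsAdmissible.intervalIntegrable_preHamiltonian (hadm : P.IsAdmissible s z x u)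
    (hcost : IntegrableOn (P.discountedCost x u) (Ioi s)) {a b : ℝ} (ha : s ≤ a) (hb : s ≤ b)
    (ξ : EuclideanSpace ℝ (Fin n)) :
    IntervalIntegrable (fun r => P.preHamiltonian r (x r) ξ (u r)) volume a b :=
  have hf := hadm.intervalIntegrable_velocity ha hb
  IntervalIntegrable.add ⟨hf.1.const_inner ξ, hf.2.const_inner ξ⟩
    (intervalIntegrable_discountedCost hcost ha hb)

lemma IsAdmissible.integral_preHamiltonian (hadm : P.IsAdmissible s z x u)
    (hcost : IntegrableOn (P.discountedCost x u) (Ioi s)) {a b : ℝ} (ha : s ≤ a) (hb : s ≤ b)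
    (p : ℝ × EuclideanSpace ℝ (Fin n)) :
    ∫ r in a..b, (p.1 + P.preHamiltonian r (x r) p.2 (u r)) =
      p.1 * (b - a) + inner ℝ p.2 (x b - x a) + ∫ r in a..b, P.discountedCost x u r := by
  have hf := hadm.intervalIntegrable_velocity ha hb
  have hcost' := intervalIntegrable_discountedCost hcost ha hb
  have hinner_int : IntervalIntegrable (fun r => inner ℝ p.2 (P.f r (x r) (u r))) volume a b :=
    ⟨hf.1.const_inner p.2, hf.2.const_inner p.2⟩
  have hinner : ∫ r in a..b, inner ℝ p.2 (P.f r (x r) (u r)) = inner ℝ p.2 (x b - x a) := by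
    rw [hadm.state_sub ha hb]
    exact (innerSL ℝ p.2).intervalIntegral_comp_comm hf
  rw [intervalIntegral.integral_add intervalIntegrable_const
      (hadm.intervalIntegrable_preHamiltonian hcost ha hb p.2),
    intervalIntegral.integral_const, smul_eq_mul, mul_comm, ← hinner, add_assoc,
    ← intervalIntegral.integral_add hinner_int hcost']
  rfl

lemma Standing.exists_preHamiltonian_modulus (hP : P.Standing) (hs : 0 ≤ s) {b : ℝ}
    (hx : ContinuousOn x (Icc s b)) (C : ℝ) {ε : ℝ} (hε : 0 < ε) :
    ∃ η : ℝ, 0 < η ∧ ∀ t ∈ Icc s b, ∀ r ∈ Icc s b, |r - t| < η → ∀ ξ, ‖ξ‖ ≤ C → ∀ v ∈ P.Ω,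
      |P.preHamiltonian r (x r) ξ v - P.preHamiltonian t (x t) ξ v| ≤ ε := by
  have hcont : ContinuousOn (fun q : ℝ × EuclideanSpace ℝ (Fin m) =>
      P.velocity q.1 (x q.1) q.2) (Icc s b ×ˢ P.Ω) :=
    hP.continuousOn_velocity.comp
      (f := fun q : ℝ × EuclideanSpace ℝ (Fin m) => (q.1, x q.1, q.2))
      (continuousOn_fst.prodMk
        ((hx.comp continuousOn_fst fun _ hq => hq.1).prodMk continuousOn_snd))
      fun _ hq => hs.trans hq.1.1
  obtain ⟨η, hη, hmod⟩ := Metric.uniformContinuousOn_iff.mp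
    ((isCompact_Icc.prod hP.compact_controls).uniformContinuousOn_of_continuous hcont)
    (ε / (1 + |C|)) (by positivity)
  refine ⟨η, hη, fun t ht r hr htr ξ hξ v hv => ?_⟩
  have hvel : ‖P.velocity r (x r) v - P.velocity t (x t) v‖ ≤ ε / (1 + |C|) := by
    rw [← dist_eq_norm]
    refine (hmod (r, v) ⟨hr, hv⟩ (t, v) ⟨ht, hv⟩ ?_).le
    rwa [Prod.dist_eq, dist_self, Real.dist_eq, max_eq_left (abs_nonneg _)]
  calc |P.preHamiltonian r (x r) ξ v - P.preHamiltonian t (x t) ξ v|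
      ≤ (1 + ‖ξ‖) * ‖P.velocity r (x r) v - P.velocity t (x t) v‖ :=
        abs_preHamiltonian_sub_le ..
    _ ≤ (1 + |C|) * (ε / (1 + |C|)) := by gcongr; exact hξ.trans (le_abs_self C)
    _ = ε := by field_simp

lemma IsAdmissible.exists_regularization (hP : P.Standing)
    {φ : ℝ → EuclideanSpace ℝ (Fin n) → ℝ}
    (hφ : ContinuousOn (Function.uncurry φ) {q | 0 ≤ q.1}) (hs : 0 ≤ s)
    (hadm : P.IsAdmissible s z x u) (hcost : IntegrableOn (P.discountedCost x u) (Ioi s))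
    (b : ℝ) {ε : ℝ} (hε : 0 < ε) :
    ∃ (V : ℝ → EuclideanSpace ℝ (Fin n) → ℝ) (η : ℝ), 0 < η ∧
      (∀ t ∈ Icc s b, |P.pathValue V x u t - P.pathValue φ x u t| ≤ ε) ∧
      ∀ t₀ ∈ Icc s b, ∃ τ y, ∃ p ∈ proximalSubgradient φ τ y, 0 ≤ τ ∧ |t₀ - τ| < ε ∧
        ∀ t₁ ∈ Icc s b, |t₁ - t₀| < η →
          (∀ r ∈ uIcc t₀ t₁, ∀ v ∈ P.Ω,
            |P.preHamiltonian r (x r) p.2 v - P.preHamiltonian τ y p.2 v| ≤ 2 * ε) ∧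
          P.pathValue V x u t₁ - P.pathValue V x u t₀ ≤
            (∫ r in t₀..t₁, (p.1 + P.preHamiltonian r (x r) p.2 (u r))) + ε * |t₁ - t₀| := by
  obtain ⟨R, hR⟩ := isCompact_Icc.exists_bound_of_continuousOn (hadm.continuousOn_state b)
  obtain ⟨B, hB⟩ := hadm.exists_norm_state_sub_le hP hs b
  obtain ⟨V, C, hV⟩ := hP.exists_isRegularization hφ b R hε
  obtain ⟨η₁, hη₁, hmod⟩ := hP.exists_preHamiltonian_modulus hs (hadm.continuousOn_state b) C hε
  obtain ⟨η₂, hη₂, hsq⟩ := exists_forall_mul_sq_add_sq_le B C hε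
  refine ⟨V, min η₁ η₂, by positivity, fun t ht => ?_, fun t₀ ht₀ => ?_⟩
  · simpa only [pathValue, sub_sub_sub_cancel_right] using
      hV.abs_sub_le t ⟨hs.trans ht.1, ht.2⟩ (x t) (hR t ht)
  obtain ⟨τ, y, p, hp, hτ, htτ, hpC, hham, hsup⟩ :=
    hV.exists_supergradient t₀ ⟨hs.trans ht₀.1, ht₀.2⟩ (x t₀) (hR t₀ ht₀)
  refine ⟨τ, y, p, hp, hτ, htτ, fun t₁ ht₁ htt => ⟨fun r hr v hv => ?_, ?_⟩⟩
  · have hrt : |r - t₀| < η₁ :=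
      (abs_sub_left_of_mem_uIcc hr).trans_lt (htt.trans_le (min_le_left _ _))
    linarith [hham v hv, hmod t₀ ht₀ r (uIcc_subset_Icc ht₀ ht₁ hr) hrt p.2 hpC v hv,
      abs_sub_le (P.preHamiltonian r (x r) p.2 v) (P.preHamiltonian t₀ (x t₀) p.2 v)
        (P.preHamiltonian τ y p.2 v)]
  · rw [pathValue_sub V hcost ht₀.1 ht₁.1, hadm.integral_preHamiltonian hcost ht₀.1 ht₁.1]
    linarith [hsup t₁ (x t₁), hsq (t₁ - t₀) ‖x t₁ - x t₀‖ (htt.trans_le (min_le_right _ _))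
      (by rw [abs_norm]; exact hB t₀ ht₀ t₁ ht₁)]

theorem nonincreasingAlongEvery_of_supMaxHJB_nonpos (hP : P.Standing)
    {φ : ℝ → EuclideanSpace ℝ (Fin n) → ℝ}
    (hφ : ContinuousOn (Function.uncurry φ) {q | 0 ≤ q.1})
    (h : ∀ s : ℝ, 0 ≤ s → ∀ z : EuclideanSpace ℝ (Fin n), P.supMaxHJB φ s z ≤ 0) :
    P.NonincreasingAlongEvery φ := by
  rintro s hs z ⟨x, u⟩ ⟨hadm, hcost⟩ a ha b hb hab
  simp only [mem_Ici] at ha hb hadm hcost ⊢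
  refine sub_nonpos.mp (nonpos_of_eventually_le_mul (K := 3 * (b - a) + 2) ?_)
  filter_upwards [self_mem_nhdsWithin] with ε hε
  obtain ⟨V, η, hη, hV, hstep⟩ := hadm.exists_regularization hP hφ hs hcost b hε
  have hchain : P.pathValue V x u b - P.pathValue V x u a ≤ 3 * ε * (b - a) := by
    refine sub_le_mul_of_forall_short hab hη fun t ht t' ht' htt' hlt => ?_
    have hts := ha.trans ht.1
    have ht's := ha.trans ht'.1
    obtain ⟨τ, y, p, hp, hτ, -, hp'⟩ := hstep t ⟨hts, ht.2⟩
    rw [← abs_of_nonneg (sub_nonneg.mpr htt')] at hlt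
    obtain ⟨hham, hle⟩ := hp' t' ⟨ht's, ht'.2⟩ hlt
    rw [abs_of_nonneg (sub_nonneg.mpr htt')] at hle
    have hint : ∫ r in t..t', (p.1 + P.preHamiltonian r (x r) p.2 (u r)) ≤ 2 * ε * (t' - t) := by
      refine intervalIntegral_le_mul_of_ae_le htt' (intervalIntegrable_const.add
        (hadm.intervalIntegrable_preHamiltonian hcost hts ht's p.2)) ?_
      filter_upwards [hadm.ae_control_mem] with r hr hrt
      have hrΩ := hr (hts.trans hrt.1.le)
      linarith [(hP.supMaxHJB_nonpos_iff hτ).mp (h τ hτ y) p hp (u r) hrΩ,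
        abs_le.mp (hham r (Ioc_subset_Icc_self.trans Icc_subset_uIcc hrt) (u r) hrΩ)]
    linarith
  linarith [abs_le.mp (hV a ⟨ha, hab⟩), abs_le.mp (hV b ⟨hb, le_rfl⟩)]

/-- The base point of each short step is its right end, which has positive time and from which the
process can be followed backward. -/
lemma pathValue_le_of_infHJB_nonneg (hP : P.Standing)
    {φ : ℝ → EuclideanSpace ℝ (Fin n) → ℝ}
    (hφ : ContinuousOn (Function.uncurry φ) {q | 0 ≤ q.1})
    (h : ∀ s : ℝ, 0 < s → ∀ z : EuclideanSpace ℝ (Fin n), 0 ≤ P.infHJB φ s z) (hs : 0 ≤ s)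
    (hadm : P.IsAdmissible s z x u) (hcost : IntegrableOn (P.discountedCost x u) (Ioi s))
    {a b : ℝ} (ha : s < a) (hab : a ≤ b) : P.pathValue φ x u a ≤ P.pathValue φ x u b := by
  refine sub_nonpos.mp (nonpos_of_eventually_le_mul (K := 3 * (b - a) + 2) ?_)
  filter_upwards [Ioo_mem_nhdsGT (hs.trans_lt ha)] with ε hε
  obtain ⟨V, η, hη, hV, hstep⟩ := hadm.exists_regularization hP hφ hs hcost b hε.1
  have hchain : -P.pathValue V x u b - -P.pathValue V x u a ≤ 3 * ε * (b - a) := by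
    refine sub_le_mul_of_forall_short (F := fun t => -P.pathValue V x u t) hab hη
      fun t ht t' ht' htt' hlt => ?_
    have hts := ha.le.trans ht.1
    have ht's := ha.le.trans ht'.1
    obtain ⟨τ, y, p, hp, -, htτ, hp'⟩ := hstep t' ⟨ht's, ht'.2⟩
    have hτ : 0 < τ := by linarith [abs_lt.mp htτ, ht'.1, hε.2]
    rw [← abs_of_nonneg (sub_nonneg.mpr htt'), abs_sub_comm] at hlt
    obtain ⟨hham, hle⟩ := hp' t ⟨hts, ht.2⟩ hlt
    rw [abs_sub_comm, abs_of_nonneg (sub_nonneg.mpr htt')] at hle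
    have hint : ∫ r in t'..t, (p.1 + P.preHamiltonian r (x r) p.2 (u r)) ≤ 2 * ε * (t' - t) := by
      rw [intervalIntegral.integral_symm, ← intervalIntegral.integral_neg]
      refine intervalIntegral_le_mul_of_ae_le htt' (intervalIntegrable_const.add
        (hadm.intervalIntegrable_preHamiltonian hcost hts ht's p.2)).neg ?_
      filter_upwards [hadm.ae_control_mem] with r hr hrt
      have hrΩ := hr (hts.trans hrt.1.le)
      linarith [(hP.infHJB_nonneg_iff hτ.le).mp (h τ hτ y) p hp (u r) hrΩ,
        abs_le.mp (hham r (Ioc_subset_Icc_self.trans Icc_subset_uIcc' hrt) (u r) hrΩ)]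
    linarith
  linarith [abs_le.mp (hV a ⟨ha.le, hab⟩), abs_le.mp (hV b ⟨ha.le.trans hab, le_rfl⟩)]

theorem nondecreasingAlongEvery_of_infHJB_nonneg (hP : P.Standing)
    {φ : ℝ → EuclideanSpace ℝ (Fin n) → ℝ}
    (hφ : ContinuousOn (Function.uncurry φ) {q | 0 ≤ q.1})
    (h : ∀ s : ℝ, 0 < s → ∀ z : EuclideanSpace ℝ (Fin n), 0 ≤ P.infHJB φ s z) :
    P.NondecreasingAlongEvery φ := by
  rintro s hs z ⟨x, u⟩ ⟨hadm, hcost⟩ a ha b hb hab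
  simp only [mem_Ici] at ha hb hadm hcost ⊢
  rcases ha.lt_or_eq with ha | rfl
  · exact pathValue_le_of_infHJB_nonneg hP hφ h hs hadm hcost ha hab
  rcases hab.eq_or_lt with rfl | hab
  · rfl
  have hright : Tendsto (P.pathValue φ x u) (𝓝[>] s) (𝓝 (P.pathValue φ x u s)) := by
    have hcont := continuousOn_pathValue hφ hs hadm.continuousOn_state hcost hb s ⟨le_rfl, hb⟩
    rw [ContinuousWithinAt, nhdsWithin_Icc_eq_nhdsGE hab] at hcont
    exact hcont.mono_left (nhdsWithin_mono _ Ioi_subset_Ici_self)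
  refine le_of_tendsto hright ?_
  filter_upwards [Ioo_mem_nhdsGT hab] with a ha
  exact pathValue_le_of_infHJB_nonneg hP hφ h hs hadm hcost ha.1 ha.2.le

end ControlProblem

/-! ### Hamilton–Jacobi inequalities from monotonicity -/

section Piecewise

variable {F : Type*} [NormedAddCommGroup F] {g₁ g₂ : ℝ → F} {a b t : ℝ}

lemma locallyIntegrableOn_Ici_piecewise (h₁ : IntegrableOn g₁ (Icc a b))
    (h₂ : LocallyIntegrableOn g₂ (Ici b)) :
    LocallyIntegrableOn ((Iic b).piecewise g₁ g₂) (Ici a) := by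
  refine (locallyIntegrableOn_iff isClosed_Ici.isLocallyClosed).mpr fun K hKa hK => ?_
  have hleft : IntegrableOn ((Iic b).piecewise g₁ g₂) (K ∩ Iic b) :=
    (h₁.mono_set fun t ht => ⟨hKa ht.1, ht.2⟩).congr_fun
      (fun t ht => (piecewise_eq_of_mem _ _ _ ht.2).symm) (hK.measurableSet.inter measurableSet_Iic)
  have hright : IntegrableOn ((Iic b).piecewise g₁ g₂) (K ∩ Ioi b) :=
    ((h₂.integrableOn_compact_subset inter_subset_right (hK.inter_right isClosed_Ici)).mono_set
      (inter_subset_inter_right K Ioi_subset_Ici_self)).congr_fun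
      (fun t ht => (piecewise_eq_of_notMem _ _ _ (notMem_Iic.mpr ht.2)).symm)
      (hK.measurableSet.inter measurableSet_Ioi)
  simpa only [← inter_union_distrib_left, Iic_union_Ioi, inter_univ] using hleft.union hright

variable [NormedSpace ℝ F]

lemma intervalIntegral_piecewise_of_le (hat : a ≤ t) (htb : t ≤ b) :
    ∫ r in a..t, (Iic b).piecewise g₁ g₂ r = ∫ r in a..t, g₁ r :=
  intervalIntegral.integral_congr fun _ hr =>
    piecewise_eq_of_mem _ _ _ ((uIcc_of_le hat ▸ hr).2.trans htb)

lemma intervalIntegral_piecewise_of_ge (hbt : b ≤ t) :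
    ∫ r in b..t, (Iic b).piecewise g₁ g₂ r = ∫ r in b..t, g₂ r :=
  intervalIntegral.integral_congr_ae <| Eventually.of_forall fun _ hr =>
    piecewise_eq_of_notMem _ _ _ (notMem_Iic.mpr (uIoc_of_le hbt ▸ hr).1)

end Piecewise

namespace ControlProblem

variable {n m : ℕ} {P : ControlProblem n m} {φ : ℝ → EuclideanSpace ℝ (Fin n) → ℝ}

section Concatenation

variable {a b : ℝ} {x₁ x₂ : ℝ → EuclideanSpace ℝ (Fin n)} {u₁ u₂ : ℝ → EuclideanSpace ℝ (Fin m)}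

lemma comp_piecewise_process {F : Type*}
    (g : ℝ → EuclideanSpace ℝ (Fin n) → EuclideanSpace ℝ (Fin m) → F) :
    (fun r => g r ((Iic b).piecewise x₁ x₂ r) ((Iic b).piecewise u₁ u₂ r)) =
      (Iic b).piecewise (fun r => g r (x₁ r) (u₁ r)) (fun r => g r (x₂ r) (u₂ r)) := by
  ext1 r
  by_cases hr : r ∈ Iic b
  · simp only [piecewise_eq_of_mem _ _ _ hr]
  · simp only [piecewise_eq_of_notMem _ _ _ hr]

lemma IsAdmissible.concat (h₂ : P.IsAdmissible b (x₁ b) x₂ u₂) (hab : a ≤ b)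
    (hu₁ : IntegrableOn u₁ (Icc a b)) (hΩ₁ : ∀ t ∈ Icc a b, u₁ t ∈ P.Ω)
    (hf₁ : IntegrableOn (fun r => P.f r (x₁ r) (u₁ r)) (Icc a b))
    (hx₁ : ∀ t ∈ Icc a b, x₁ t = x₁ a + ∫ r in a..t, P.f r (x₁ r) (u₁ r)) :
    P.IsAdmissible a (x₁ a) ((Iic b).piecewise x₁ x₂) ((Iic b).piecewise u₁ u₂) := by
  have hvel := locallyIntegrableOn_Ici_piecewise hf₁ h₂.velocity_locallyIntegrable
  refine ⟨locallyIntegrableOn_Ici_piecewise hu₁ h₂.control_locallyIntegrable, ?_, ?_,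
    fun t ht => ?_⟩
  · refine (ae_restrict_iff' measurableSet_Ici).mpr ?_
    filter_upwards [h₂.ae_control_mem] with t ht₂ hat
    rcases le_or_gt t b with htb | hbt
    · rw [piecewise_eq_of_mem _ _ _ (mem_Iic.mpr htb)]
      exact hΩ₁ t ⟨hat, htb⟩
    · rw [piecewise_eq_of_notMem _ _ _ (notMem_Iic.mpr hbt)]
      exact ht₂ hbt.le
  · rwa [comp_piecewise_process P.f]
  rw [comp_piecewise_process P.f]
  rcases le_or_gt t b with htb | hbt
  · rw [piecewise_eq_of_mem _ _ _ (mem_Iic.mpr htb), intervalIntegral_piecewise_of_le ht htb,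
      hx₁ t ⟨ht, htb⟩]
  · rw [piecewise_eq_of_notMem _ _ _ (notMem_Iic.mpr hbt), h₂.state_eq t hbt.le,
      ← intervalIntegral.integral_add_adjacent_intervals
        (intervalIntegrable_of_locallyIntegrableOn_Ici hvel le_rfl hab)
        (intervalIntegrable_of_locallyIntegrableOn_Ici hvel hab ht),
      intervalIntegral_piecewise_of_le hab le_rfl, intervalIntegral_piecewise_of_ge hbt.le,
      ← add_assoc, ← hx₁ b ⟨hab, le_rfl⟩]

lemma integrableOn_discountedCost_concat (hab : a ≤ b)
    (h₁ : IntegrableOn (P.discountedCost x₁ u₁) (Icc a b))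
    (h₂ : IntegrableOn (P.discountedCost x₂ u₂) (Ioi b)) :
    IntegrableOn
      (P.discountedCost ((Iic b).piecewise x₁ x₂) ((Iic b).piecewise u₁ u₂)) (Ioi a) := by
  unfold discountedCost at h₁ h₂ ⊢
  rw [comp_piecewise_process fun r x u => Real.exp (-P.δ * r) * P.l r x u,
    ← Ioc_union_Ioi_eq_Ioi hab]
  refine ((h₁.mono_set Ioc_subset_Icc_self).congr_fun (fun r hr => ?_) measurableSet_Ioc).union
    (h₂.congr_fun (fun r hr => ?_) measurableSet_Ioi)
  · rw [piecewise_eq_of_mem _ _ _ (mem_Iic.mpr hr.2)]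
  · rw [piecewise_eq_of_notMem _ _ _ (notMem_Iic.mpr hr)]

end Concatenation

namespace Standing

lemma exists_mem_finiteCostProcesses_extending (hP : P.Standing) {a b : ℝ} (ha : 0 ≤ a)
    (hab : a ≤ b) {y : ℝ → EuclideanSpace ℝ (Fin n)} {v : EuclideanSpace ℝ (Fin m)} (hv : v ∈ P.Ω)
    (hy : ∀ t ∈ Icc a b, HasDerivWithinAt y (P.f t (y t) v) (Icc a b) t)
    (hne : (P.finiteCostProcesses b (y b)).Nonempty) :
    ∃ p ∈ P.finiteCostProcesses a (y a), EqOn p.1 y (Icc a b) ∧ ∀ t ∈ Icc a b, p.2 t = v := by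
  obtain ⟨⟨x₂, u₂⟩, hadm, hcost⟩ := hne
  have hyc : ContinuousOn y (Icc a b) := fun t ht => (hy t ht).continuousWithinAt
  have hvel : ContinuousOn (fun t => P.velocity t (y t) v) (Icc a b) :=
    hP.continuousOn_velocity.comp (f := fun t => (t, y t, v))
      (continuousOn_id.prodMk (hyc.prodMk continuousOn_const)) fun t ht => ha.trans ht.1
  have hstate : ∀ t ∈ Icc a b, y t = y a + ∫ r in a..t, P.f r (y r) v := fun t ht => by
    have hsub : Icc a t ⊆ Icc a b := Icc_subset_Icc_right ht.2
    rw [intervalIntegral.integral_eq_sub_of_hasDerivAt_of_le ht.1 (hyc.mono hsub)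
      (fun r hr => (hy r (hsub (Ioo_subset_Icc_self hr))).hasDerivAt
        (Icc_mem_nhds hr.1 (hr.2.trans_le ht.2)))
      ((hvel.snd.mono hsub).intervalIntegrable_of_Icc ht.1), add_sub_cancel]
  exact ⟨((Iic b).piecewise y x₂, (Iic b).piecewise (fun _ => v) u₂),
    ⟨hadm.concat hab (integrableOn_const (by simp)) (fun _ _ => hv)
      (hvel.snd.integrableOn_compact isCompact_Icc) hstate,
    integrableOn_discountedCost_concat hab (hvel.fst.integrableOn_compact isCompact_Icc) hcost⟩,
    fun t ht => piecewise_eq_of_mem _ _ _ (mem_Iic.mpr ht.2),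
    fun t ht => piecewise_eq_of_mem _ (fun _ => v) _ (mem_Iic.mpr ht.2)⟩

/-- At negative times `f` is frozen at time `0`, so that Picard–Lindelöf applies around `s = 0`. -/
lemma exists_isPicardLindelof (hP : P.Standing) (s : ℝ) (z : EuclideanSpace ℝ (Fin n))
    {v : EuclideanSpace ℝ (Fin m)} (hv : v ∈ P.Ω) {ε₀ : ℝ} (hε₀ : 0 < ε₀) :
    ∃ (ε : ℝ) (hs : s ∈ Icc (s - ε) (s + ε)) (L K : NNReal), 0 < ε ∧ ε ≤ ε₀ ∧
      IsPicardLindelof (fun t y => P.f (max t 0) y v) ⟨s, hs⟩ z 1 0 L K := by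
  obtain ⟨K₁, hK₁, hLip⟩ := hP.exists_norm_velocity_sub_le
  obtain ⟨K, hK, hgrowth⟩ := hP.exists_norm_velocity_le
  have hL : 0 < K * (2 + ‖z‖) := by positivity
  have hε : 0 < min ε₀ (1 / (K * (2 + ‖z‖))) := by positivity
  refine ⟨min ε₀ (1 / (K * (2 + ‖z‖))), ⟨by linarith, by linarith⟩, (K * (2 + ‖z‖)).toNNReal,
    K₁.toNNReal, hε, min_le_left _ _, fun t _ => ?_, fun y _ => ?_, fun t _ y hy => ?_, ?_⟩
  · refine (LipschitzWith.of_dist_le_mul fun y y' => ?_).lipschitzOnWith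
    rw [dist_eq_norm, dist_eq_norm, Real.coe_toNNReal _ hK₁.le]
    exact (norm_snd_le (P.velocity (max t 0) y v - P.velocity (max t 0) y' v)).trans
      (hLip _ (le_max_right t 0) y y' v hv)
  · exact hP.continuous_f.comp (f := fun t : ℝ => (max t 0, y, v))
      (Continuous.continuousOn (by fun_prop)) fun t _ => le_max_right t 0
  · have hyz : ‖y‖ ≤ 1 + ‖z‖ := by
      rw [mem_closedBall_iff_norm, NNReal.coe_one] at hy
      linarith [norm_sub_norm_le y z]
    calc ‖P.f (max t 0) y v‖ ≤ ‖P.velocity (max t 0) y v‖ := norm_snd_le (P.velocity (max t 0) y v)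
      _ ≤ K * (1 + ‖y‖) := hgrowth _ (le_max_right t 0) y v hv
      _ ≤ K * (2 + ‖z‖) := mul_le_mul_of_nonneg_left (by linarith) hK.le
      _ = _ := (Real.coe_toNNReal _ hL.le).symm
  · simp only [Real.coe_toNNReal _ hL.le, NNReal.coe_one, NNReal.coe_zero, add_sub_cancel_left,
      sub_sub_cancel, max_self, sub_zero]
    rw [mul_comm]
    exact (le_div_iff₀ hL).mp (min_le_right _ _)

lemma exists_local_solution (hP : P.Standing) (s : ℝ) (z : EuclideanSpace ℝ (Fin n))
    {v : EuclideanSpace ℝ (Fin m)} (hv : v ∈ P.Ω) {ε₀ : ℝ} (hε₀ : 0 < ε₀) :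
    ∃ (ε : ℝ) (y : ℝ → EuclideanSpace ℝ (Fin n)), 0 < ε ∧ ε ≤ ε₀ ∧ y s = z ∧
      ∀ a b, Icc a b ⊆ Icc (s - ε) (s + ε) → 0 ≤ a →
        ∀ t ∈ Icc a b, HasDerivWithinAt y (P.f t (y t) v) (Icc a b) t := by
  obtain ⟨ε, hs, L, K, hε, hεε₀, hpl⟩ := hP.exists_isPicardLindelof s z hv hε₀
  obtain ⟨y, hys, hy⟩ := hpl.exists_eq_forall_mem_Icc_hasDerivWithinAt₀
  refine ⟨ε, y, hε, hεε₀, hys, fun a b hab ha t ht => ?_⟩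
  simpa only [max_eq_left (ha.trans ht.1)] using (hy t (hab ht)).mono hab

end Standing

section NecessaryConditions

variable {s b : ℝ} {z : EuclideanSpace ℝ (Fin n)} {x : ℝ → EuclideanSpace ℝ (Fin n)}
  {u : ℝ → EuclideanSpace ℝ (Fin m)} {p : ℝ × EuclideanSpace ℝ (Fin n)}

lemma IsAdmissible.eventually_integral_le (hP : P.Standing) (hs : 0 ≤ s)
    (hadm : P.IsAdmissible s z x u) (hcost : IntegrableOn (P.discountedCost x u) (Ioi s))
    {t₀ ε : ℝ} (ht₀ : t₀ ∈ Icc s b) (hp : p ∈ proximalSubgradient φ t₀ (x t₀)) (hε : 0 < ε) :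
    ∀ᶠ t₁ in 𝓝[Icc s b] t₀,
      (∀ r ∈ uIcc t₀ t₁, ∀ v ∈ P.Ω,
        |P.preHamiltonian r (x r) p.2 v - P.preHamiltonian t₀ (x t₀) p.2 v| ≤ ε) ∧
      ∫ r in t₀..t₁, (p.1 + P.preHamiltonian r (x r) p.2 (u r)) ≤
        P.pathValue φ x u t₁ - P.pathValue φ x u t₀ + ε * |t₁ - t₀| := by
  obtain ⟨σ, -, hprox⟩ := hp
  obtain ⟨B, hB⟩ := hadm.exists_norm_state_sub_le hP hs b
  obtain ⟨η₁, hη₁, hmod⟩ :=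
    hP.exists_preHamiltonian_modulus hs (hadm.continuousOn_state b) ‖p.2‖ hε
  obtain ⟨η₂, hη₂, hsq⟩ := exists_forall_mul_sq_add_sq_le B σ hε
  have hcurve : Tendsto (fun t => (t, x t)) (𝓝[Icc s b] t₀) (𝓝[{q | 0 ≤ q.1}] (t₀, x t₀)) :=
    (continuousWithinAt_id.prodMk (hadm.continuousOn_state b t₀ ht₀)).tendsto_nhdsWithin
      fun t ht => hs.trans ht.1
  have hclose : ∀ᶠ t₁ in 𝓝[Icc s b] t₀, |t₁ - t₀| < min η₁ η₂ :=
    nhdsWithin_le_nhds (Metric.ball_mem_nhds t₀ (by positivity))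
  filter_upwards [hcurve.eventually hprox, hclose, self_mem_nhdsWithin] with t₁ hφ₁ htt ht₁
  refine ⟨fun r hr v hv => hmod t₀ ht₀ r (uIcc_subset_Icc ht₀ ht₁ hr)
    ((abs_sub_left_of_mem_uIcc hr).trans_lt (htt.trans_le (min_le_left _ _))) p.2 le_rfl v hv, ?_⟩
  rw [hadm.integral_preHamiltonian hcost ht₀.1 ht₁.1, pathValue_sub φ hcost ht₀.1 ht₁.1]
  linarith [hsq (t₁ - t₀) ‖x t₁ - x t₀‖ (htt.trans_le (min_le_right _ _))
    (by rw [abs_norm]; exact hB t₀ ht₀ t₁ ht₁)]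

lemma IsAdmissible.add_nonpos_of_pathValue_le (hP : P.Standing) (hs : 0 ≤ s)
    (hadm : P.IsAdmissible s z x u) (hcost : IntegrableOn (P.discountedCost x u) (Ioi s))
    (hsb : s < b) (hp : p ∈ proximalSubgradient φ s (x s))
    (hle : ∀ t ∈ Icc s b, P.pathValue φ x u t ≤ P.pathValue φ x u s) {c : ℝ}
    (hc : ∀ r ∈ Icc s b, u r ∈ P.Ω → c ≤ P.preHamiltonian s (x s) p.2 (u r)) :
    p.1 + c ≤ 0 := by
  refine nonpos_of_eventually_le_mul (K := 2) ?_
  filter_upwards [self_mem_nhdsWithin] with ε hε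
  have hev := hadm.eventually_integral_le hP hs hcost (left_mem_Icc.mpr hsb.le) hp hε
  rw [nhdsWithin_Icc_eq_nhdsGE hsb] at hev
  obtain ⟨t, ⟨hham, hup⟩, hst, htb⟩ :=
    ((hev.filter_mono (nhdsWithin_mono _ Ioi_subset_Ici_self)).and (Ioo_mem_nhdsGT hsb)).exists
  have hlow : -∫ r in s..t, (p.1 + P.preHamiltonian r (x r) p.2 (u r)) ≤
      -(p.1 + c - ε) * (t - s) := by
    rw [← intervalIntegral.integral_neg]
    refine intervalIntegral_le_mul_of_ae_le hst.le (intervalIntegrable_const.add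
      (hadm.intervalIntegrable_preHamiltonian hcost le_rfl hst.le p.2)).neg ?_
    filter_upwards [hadm.ae_control_mem] with r hr hrt
    have hrΩ := hr hrt.1.le
    linarith [hc r ⟨hrt.1.le, hrt.2.trans htb.le⟩ hrΩ,
      abs_le.mp (hham r (Ioc_subset_Icc_self.trans Icc_subset_uIcc hrt) (u r) hrΩ)]
  rw [abs_of_pos (sub_pos.mpr hst)] at hup
  refine le_of_mul_le_mul_right ?_ (sub_pos.mpr hst)
  linarith [hle t ⟨hst.le, htb.le⟩]

lemma IsAdmissible.add_nonneg_of_pathValue_le (hP : P.Standing) (hs : 0 ≤ s)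
    (hadm : P.IsAdmissible s z x u) (hcost : IntegrableOn (P.discountedCost x u) (Ioi s))
    (hsb : s < b) (hp : p ∈ proximalSubgradient φ b (x b))
    (hle : ∀ t ∈ Icc s b, P.pathValue φ x u t ≤ P.pathValue φ x u b) {c : ℝ}
    (hc : ∀ r ∈ Icc s b, u r ∈ P.Ω → P.preHamiltonian b (x b) p.2 (u r) ≤ c) :
    0 ≤ p.1 + c := by
  refine neg_nonpos.mp (nonpos_of_eventually_le_mul (K := 2) ?_)
  filter_upwards [self_mem_nhdsWithin] with ε hε
  have hev := hadm.eventually_integral_le hP hs hcost (right_mem_Icc.mpr hsb.le) hp hε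
  rw [nhdsWithin_Icc_eq_nhdsLE hsb] at hev
  obtain ⟨t, ⟨hham, hup⟩, hst, htb⟩ :=
    ((hev.filter_mono (nhdsWithin_mono _ Iio_subset_Iic_self)).and (Ioo_mem_nhdsLT hsb)).exists
  have hlow : ∫ r in t..b, (p.1 + P.preHamiltonian r (x r) p.2 (u r)) ≤
      (p.1 + c + ε) * (b - t) := by
    refine intervalIntegral_le_mul_of_ae_le htb.le (intervalIntegrable_const.add
      (hadm.intervalIntegrable_preHamiltonian hcost hst.le hsb.le p.2)) ?_
    filter_upwards [hadm.ae_control_mem] with r hr hrt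
    have hrΩ := hr (hst.le.trans hrt.1.le)
    linarith [hc r ⟨hst.le.trans hrt.1.le, hrt.2⟩ hrΩ,
      abs_le.mp (hham r (Ioc_subset_Icc_self.trans Icc_subset_uIcc' hrt) (u r) hrΩ)]
  rw [intervalIntegral.integral_symm, abs_sub_comm, abs_of_pos (sub_pos.mpr htb)] at hup
  refine le_of_mul_le_mul_right ?_ (sub_pos.mpr htb)
  linarith [hle t ⟨hst.le, htb.le⟩]

theorem supHJB_nonpos_of_nonincreasingAlongSome (hP : P.Standing)
    (h : P.NonincreasingAlongSome φ) (hs : 0 ≤ s) (z : EuclideanSpace ℝ (Fin n)) :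
    P.supHJB φ s z ≤ 0 := by
  refine (hP.supHJB_nonpos_iff hs).mpr fun p hp => ?_
  obtain ⟨⟨x, u⟩, ⟨hadm, hcost⟩, hanti⟩ := h s hs z
  obtain rfl : x s = z := by simpa using hadm.state_eq s le_rfl
  obtain ⟨v, hv, hmin⟩ := hP.compact_controls.exists_isMinOn hP.controls_nonempty
    (hP.continuous_preHamiltonian hs (x s) p.2).continuousOn
  exact ⟨v, hv, hadm.add_nonpos_of_pathValue_le hP hs hcost (lt_add_one s) hp
    (fun t ht => hanti self_mem_Ici ht.1 ht.1) fun r _ hr => hmin hr⟩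

theorem supMaxHJB_nonpos_of_nonincreasingAlongEvery (hP : P.Standing)
    (hne : ∀ τ : ℝ, 0 ≤ τ → ∀ y, (P.finiteCostProcesses τ y).Nonempty)
    (h : P.NonincreasingAlongEvery φ) (hs : 0 ≤ s) (z : EuclideanSpace ℝ (Fin n)) :
    P.supMaxHJB φ s z ≤ 0 := by
  refine (hP.supMaxHJB_nonpos_iff hs).mpr fun p hp v hv => ?_
  obtain ⟨ε, y, hε, -, rfl, hy⟩ := hP.exists_local_solution s z hv one_pos
  have hlt : s < s + ε := lt_add_of_pos_right s hε
  obtain ⟨⟨x, u⟩, hxu, hxy, huv⟩ := hP.exists_mem_finiteCostProcesses_extending hs hlt.le hv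
    (hy s _ (Icc_subset_Icc_left (sub_le_self s hε.le)) hs) (hne _ (hs.trans hlt.le) _)
  have hanti := h s hs (y s) (x, u) hxu
  rw [← hxy (left_mem_Icc.mpr hlt.le)] at hp ⊢
  refine hxu.1.add_nonpos_of_pathValue_le hP hs hxu.2 hlt hp
    (fun t ht => hanti self_mem_Ici ht.1 ht.1) fun r hr _ => ?_
  rw [huv r hr]

theorem infHJB_nonneg_of_nondecreasingAlongEvery (hP : P.Standing)
    (hne : ∀ τ : ℝ, 0 ≤ τ → ∀ y, (P.finiteCostProcesses τ y).Nonempty)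
    (h : P.NondecreasingAlongEvery φ) (hs : 0 < s) (z : EuclideanSpace ℝ (Fin n)) :
    0 ≤ P.infHJB φ s z := by
  refine (hP.infHJB_nonneg_iff hs.le).mpr fun p hp v hv => ?_
  obtain ⟨ε, y, hε, hεs, rfl, hy⟩ := hP.exists_local_solution s z hv hs
  have hlt : s - ε < s := sub_lt_self s hε
  have hsε : 0 ≤ s - ε := sub_nonneg.mpr hεs
  obtain ⟨⟨x, u⟩, hxu, hxy, huv⟩ := hP.exists_mem_finiteCostProcesses_extending hsε hlt.le hv
    (hy _ s (Icc_subset_Icc_right (le_add_of_nonneg_right hε.le)) hsε) (hne s hs.le _)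
  have hmono := h (s - ε) hsε _ (x, u) hxu
  rw [← hxy (right_mem_Icc.mpr hlt.le)] at hp ⊢
  refine hxu.1.add_nonneg_of_pathValue_le hP hsε hxu.2 hlt hp
    (fun t ht => hmono ht.1 hlt.le ht.2) fun r hr _ => ?_
  rw [huv r hr]

end NecessaryConditions

end ControlProblem

/-! ### Euler polygons -/

section Euler

/-- The discrete Gronwall bound for Euler polygons on `[s, T]`, if `‖g(t, y)‖ ≤ K (1 + ‖y‖)`. -/
noncomputable def eulerBound {E : Type*} [NormedAddCommGroup E] (K s T : ℝ) (y₀ : E) : ℝ :=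
  (1 + ‖y₀‖) * Real.exp (K * (T - s))

lemma eulerBound_nonneg {E : Type*} [NormedAddCommGroup E] (K s T : ℝ) (y₀ : E) :
    0 ≤ eulerBound K s T y₀ := by
  unfold eulerBound
  positivity

variable {E : Type*} [NormedAddCommGroup E] [NormedSpace ℝ E]

/-- The nodes of the Euler polygon with step size `h` for `y' = g(t, y)`, `y(s) = y₀`. The field
`g` need not be continuous: it will contain a discontinuous feedback. -/
def eulerNode (g : ℝ → E → E) (s : ℝ) (y₀ : E) (h : ℝ) : ℕ → E
  | 0 => y₀
  | i + 1 => eulerNode g s y₀ h i + h • g (s + i * h) (eulerNode g s y₀ h i)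

/-- The index of the last node of an Euler polygon up to time `t`. -/
noncomputable def eulerIndex (s h t : ℝ) : ℕ :=
  ⌊(t - s) / h⌋₊

/-- The piecewise constant interpolation of the nodes of an Euler polygon. -/
noncomputable def eulerArc (g : ℝ → E → E) (s : ℝ) (y₀ : E) (h t : ℝ) : E :=
  eulerNode g s y₀ h (eulerIndex s h t)

variable {g : ℝ → E → E} {s h t t' T K : ℝ} {y₀ : E} {i j : ℕ}

lemma eulerIndex_mul_le (hh : 0 < h) (ht : s ≤ t) : eulerIndex s h t * h ≤ t - s :=
  (le_div_iff₀ hh).mp (Nat.floor_le (div_nonneg (sub_nonneg.mpr ht) hh.le))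

lemma lt_eulerIndex_add_one_mul (hh : 0 < h) (t : ℝ) : t - s < (eulerIndex s h t + 1) * h :=
  (div_lt_iff₀ hh).mp (Nat.lt_floor_add_one _)

lemma eulerIndex_le_eulerIndex (hh : 0 < h) (htt : t ≤ t') :
    eulerIndex s h t ≤ eulerIndex s h t' :=
  Nat.floor_le_floor (div_le_div_of_nonneg_right (sub_le_sub_right htt s) hh.le)

lemma eulerNode_sub_eq_sum (hij : i ≤ j) : eulerNode g s y₀ h j - eulerNode g s y₀ h i =
    ∑ k ∈ Finset.Ico i j, h • g (s + k * h) (eulerNode g s y₀ h k) := by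
  induction j, hij using Nat.le_induction with
  | base => simp
  | succ j hj ih =>
    rw [Finset.sum_Ico_succ_top hj, ← ih, eulerNode]
    abel

lemma eulerNode_le_of_step_le (hh : 0 < h) {W : ℝ → E → ℝ} {c : ℝ}
    (hstep : ∀ k : ℕ, s + k * h ≤ T → W (s + k * h + h) (eulerNode g s y₀ h (k + 1)) ≤
      W (s + k * h) (eulerNode g s y₀ h k) + c * h) (hij : i ≤ j) (hj : s + j * h ≤ T) :
    W (s + j * h) (eulerNode g s y₀ h j) ≤
      W (s + i * h) (eulerNode g s y₀ h i) + c * ((j - i) * h) := by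
  induction j, hij using Nat.le_induction with
  | base => simp
  | succ j _ ih =>
    push_cast at hj ⊢
    have hj' : s + j * h ≤ T := by linarith
    rw [show s + ((j : ℝ) + 1) * h = s + j * h + h by ring]
    linarith [ih hj', hstep j hj']

lemma smul_eulerNode_sub_mem (hh : 0 < h) (hij : i < j) {S : Set E} (hS : Convex ℝ S)
    (hmem : ∀ k, i ≤ k → k < j → g (s + k * h) (eulerNode g s y₀ h k) ∈ S) :
    (((j : ℝ) - i) * h)⁻¹ • (eulerNode g s y₀ h j - eulerNode g s y₀ h i) ∈ S := by
  have hij' : (0 : ℝ) < j - i := sub_pos.mpr (Nat.cast_lt.mpr hij)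
  rw [eulerNode_sub_eq_sum hij.le, Finset.smul_sum]
  simp only [smul_smul]
  refine hS.sum_mem (fun k _ => by positivity) ?_ fun k hk =>
    hmem k (Finset.mem_Ico.mp hk).1 (Finset.mem_Ico.mp hk).2
  rw [Finset.sum_const, Nat.card_Ico, nsmul_eq_mul, Nat.cast_sub hij.le]
  field_simp

lemma one_add_norm_eulerNode_le_exp (hh : 0 < h) (hK : 0 ≤ K)
    (hg : ∀ t, s ≤ t → ∀ y, ‖g t y‖ ≤ K * (1 + ‖y‖)) (i : ℕ) :
    1 + ‖eulerNode g s y₀ h i‖ ≤ (1 + ‖y₀‖) * Real.exp (K * (i * h)) := by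
  induction i with
  | zero => simp [eulerNode]
  | succ i ih =>
    have hstep : ‖eulerNode g s y₀ h (i + 1)‖ ≤ ‖eulerNode g s y₀ h i‖ +
        h * (K * (1 + ‖eulerNode g s y₀ h i‖)) := by
      refine (norm_add_le _ _).trans (add_le_add_right ?_ _)
      rw [norm_smul, Real.norm_of_nonneg hh.le]
      gcongr
      exact hg _ (le_add_of_nonneg_right (by positivity)) _
    calc 1 + ‖eulerNode g s y₀ h (i + 1)‖
        ≤ (1 + ‖eulerNode g s y₀ h i‖) * (K * h + 1) := by linarith
      _ ≤ ((1 + ‖y₀‖) * Real.exp (K * (i * h))) * Real.exp (K * h) := by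
        gcongr
        exact Real.add_one_le_exp _
      _ = (1 + ‖y₀‖) * Real.exp (K * ((i + 1 : ℕ) * h)) := by
        rw [mul_assoc, ← Real.exp_add]
        push_cast
        ring_nf

lemma one_add_norm_eulerNode_le (hh : 0 < h) (hK : 0 ≤ K)
    (hg : ∀ t, s ≤ t → ∀ y, ‖g t y‖ ≤ K * (1 + ‖y‖)) (hi : s + i * h ≤ T) :
    1 + ‖eulerNode g s y₀ h i‖ ≤ eulerBound K s T y₀ := by
  refine (one_add_norm_eulerNode_le_exp hh hK hg i).trans ?_
  unfold eulerBound
  gcongr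
  linarith

lemma norm_eulerNode_sub_le (hh : 0 < h) (hK : 0 ≤ K)
    (hg : ∀ t, s ≤ t → ∀ y, ‖g t y‖ ≤ K * (1 + ‖y‖)) (hij : i ≤ j) (hj : s + j * h ≤ T) :
    ‖eulerNode g s y₀ h j - eulerNode g s y₀ h i‖ ≤
      K * eulerBound K s T y₀ * ((j - i) * h) := by
  rw [eulerNode_sub_eq_sum hij]
  calc ‖∑ k ∈ Finset.Ico i j, h • g (s + k * h) (eulerNode g s y₀ h k)‖
      ≤ ∑ _k ∈ Finset.Ico i j, h * (K * eulerBound K s T y₀) := by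
        refine norm_sum_le_of_le _ fun k hk => ?_
        have hkj : (k : ℝ) * h ≤ j * h := by
          gcongr
          exact (Finset.mem_Ico.mp hk).2.le
        rw [norm_smul, Real.norm_of_nonneg hh.le]
        gcongr
        refine (hg _ (le_add_of_nonneg_right (by positivity)) _).trans ?_
        gcongr
        exact one_add_norm_eulerNode_le hh hK hg (by linarith)
    _ = K * eulerBound K s T y₀ * ((j - i) * h) := by
        rw [Finset.sum_const, Nat.card_Ico, nsmul_eq_mul, Nat.cast_sub hij]
        ring

lemma norm_eulerArc_sub_le (hh : 0 < h) (hK : 0 ≤ K)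
    (hg : ∀ t, s ≤ t → ∀ y, ‖g t y‖ ≤ K * (1 + ‖y‖)) (ht : s ≤ t) (htt : t ≤ t') (htT : t' ≤ T) :
    ‖eulerArc g s y₀ h t' - eulerArc g s y₀ h t‖ ≤
      K * eulerBound K s T y₀ * (t' - t + h) := by
  have hle := eulerIndex_mul_le hh (ht.trans htt)
  refine (norm_eulerNode_sub_le hh hK hg (T := T) (eulerIndex_le_eulerIndex hh htt)
    (by linarith)).trans ?_
  have := eulerBound_nonneg K s T y₀
  gcongr
  linarith [lt_eulerIndex_add_one_mul (s := s) hh t]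

/-- `Y` is a pointwise limit of Euler polygons with vanishing step sizes, for fields `g k` of
uniformly linear growth. -/
structure IsEulerLimit {ι : Type*} (F : Filter ι) (g : ι → ℝ → E → E) (h : ι → ℝ) (K s : ℝ)
    (y₀ : E) (Y : ℝ → E) : Prop where
  growth_nonneg : 0 ≤ K
  norm_le : ∀ k t, s ≤ t → ∀ y, ‖g k t y‖ ≤ K * (1 + ‖y‖)
  step_pos : ∀ k, 0 < h k
  tendsto_step : Tendsto h F (𝓝 0)
  tendsto_arc : ∀ t, s ≤ t → Tendsto (fun k => eulerArc (g k) s y₀ (h k) t) F (𝓝 (Y t))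

lemma exists_isEulerLimit [ProperSpace E] {ι : Type*} (F : Ultrafilter ι) {g : ι → ℝ → E → E}
    {h : ι → ℝ} (hK : 0 ≤ K) (hg : ∀ k t, s ≤ t → ∀ y, ‖g k t y‖ ≤ K * (1 + ‖y‖))
    (hh : ∀ k, 0 < h k) (hF : Tendsto h F (𝓝 0)) (y₀ : E) :
    ∃ Y, IsEulerLimit (F : Filter ι) g h K s y₀ Y := by
  have hlim : ∀ t, ∃ y, s ≤ t → Tendsto (fun k => eulerArc (g k) s y₀ (h k) t) F (𝓝 y) := by
    intro t
    by_cases ht : s ≤ t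
    · have hmem : ∀ k, eulerArc (g k) s y₀ (h k) t ∈
          Metric.closedBall (0 : E) (eulerBound K s t y₀) := fun k => by
        have hbound := one_add_norm_eulerNode_le (y₀ := y₀) (i := eulerIndex s (h k) t) (T := t)
          (hh k) hK (hg k) (by linarith [eulerIndex_mul_le (hh k) ht])
        rw [mem_closedBall_zero_iff]
        exact (lt_one_add _).le.trans hbound
      obtain ⟨y, -, hy⟩ := (isCompact_closedBall (0 : E) (eulerBound K s t y₀)).ultrafilter_le_nhds
        (F.map fun k => eulerArc (g k) s y₀ (h k) t)
        (le_principal_iff.mpr (Ultrafilter.mem_map.mpr (univ_mem' hmem)))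
      exact ⟨y, fun _ => hy⟩
    · exact ⟨0, fun hst => absurd hst ht⟩
  choose Y hY using hlim
  exact ⟨Y, hK, hg, hh, hF, hY⟩

namespace IsEulerLimit

variable {ι : Type*} {F : Filter ι} {g : ι → ℝ → E → E} {h : ι → ℝ} {Y : ℝ → E}

lemma tendsto_time (hY : IsEulerLimit F g h K s y₀ Y) (ht : s ≤ t) :
    Tendsto (fun k => s + eulerIndex s (h k) t * h k) F (𝓝 t) := by
  have hlow : Tendsto (fun k => t - h k) F (𝓝 t) := by
    simpa using tendsto_const_nhds.sub hY.tendsto_step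
  refine tendsto_of_tendsto_of_tendsto_of_le_of_le hlow tendsto_const_nhds (fun k => ?_) fun k => ?_
  · linarith [lt_eulerIndex_add_one_mul (s := s) (hY.step_pos k) t]
  · linarith [eulerIndex_mul_le (hY.step_pos k) ht]

lemma tendsto_comp {X : Type*} [TopologicalSpace X] {ψ : ℝ × E → X}
    (hY : IsEulerLimit F g h K s y₀ Y) (hψ : ContinuousOn ψ {q | s ≤ q.1}) (ht : s ≤ t) :
    Tendsto (fun k => ψ (s + eulerIndex s (h k) t * h k, eulerArc (g k) s y₀ (h k) t)) F
      (𝓝 (ψ (t, Y t))) := by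
  refine (hψ (t, Y t) ht).tendsto.comp (tendsto_nhdsWithin_of_tendsto_nhds_of_eventually_within _
    ((hY.tendsto_time ht).prodMk_nhds (hY.tendsto_arc t ht)) (Eventually.of_forall fun k => ?_))
  exact le_add_of_nonneg_right (mul_nonneg (Nat.cast_nonneg _) (hY.step_pos k).le)

lemma eventually_eulerNode_mem (hY : IsEulerLimit F g h K s y₀ Y) (ht : s ≤ t) {U : Set (ℝ × E)}
    (hU : U ∈ 𝓝 (t, Y t)) :
    ∀ᶠ t' in 𝓝[>] t, ∀ᶠ k in F, ∀ l, eulerIndex s (h k) t ≤ l → l < eulerIndex s (h k) t' →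
      (s + l * h k, eulerNode (g k) s y₀ (h k) l) ∈ U := by
  obtain ⟨η, hη, hηU⟩ := Metric.mem_nhds_iff.mp hU
  set B := K * eulerBound K s (t + 1) y₀
  have hB : 0 ≤ B := mul_nonneg hY.growth_nonneg (eulerBound_nonneg K s (t + 1) y₀)
  have hsmall : ∀ᶠ t' in 𝓝[>] t, B * (t' - t) < η / 2 :=
    nhdsWithin_le_nhds <| ContinuousAt.eventually_lt (by fun_prop) continuousAt_const
      (by simpa using hη)
  filter_upwards [Ioo_mem_nhdsGT (lt_add_of_pos_right t (lt_min one_pos hη)), hsmall]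
    with t' ⟨htt', ht'η⟩ hBt'
  have hdist : Tendsto (fun k => B * (t' - t + h k)) F (𝓝 (B * (t' - t))) := by
    simpa using (tendsto_const_nhds.add hY.tendsto_step).const_mul B
  filter_upwards [hY.tendsto_step.eventually (gt_mem_nhds hη),
    hdist.eventually (gt_mem_nhds hBt'),
    (hY.tendsto_arc t ht).eventually (Metric.ball_mem_nhds _ (half_pos hη))]
    with k hkη hBk harc l hil hlj
  have hk := hY.step_pos k
  have hi : (eulerIndex s (h k) t : ℝ) * h k ≤ l * h k := by gcongr
  have hj : (l : ℝ) * h k ≤ eulerIndex s (h k) t' * h k := by gcongr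
  have hup := eulerIndex_mul_le hk (ht.trans htt'.le)
  have hlow := lt_eulerIndex_add_one_mul (s := s) hk t
  have hη₁ := min_le_left 1 η
  have hη₂ := min_le_right 1 η
  have hnode : dist (eulerNode (g k) s y₀ (h k) l) (eulerArc (g k) s y₀ (h k) t) ≤
      B * (t' - t + h k) := by
    rw [dist_eq_norm]
    exact (norm_eulerNode_sub_le hk hY.growth_nonneg (hY.norm_le k) (T := t + 1) hil
      (by linarith)).trans (mul_le_mul_of_nonneg_left (by linarith) hB)
  refine hηU (Metric.mem_ball.mpr (max_lt ?_ ?_))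
  · rw [Real.dist_eq, abs_lt]
    constructor <;> linarith
  · linarith [dist_triangle (eulerNode (g k) s y₀ (h k) l) (eulerArc (g k) s y₀ (h k) t) (Y t),
      Metric.mem_ball.mp harc]

variable [F.NeBot]

lemma apply_start (hY : IsEulerLimit F g h K s y₀ Y) : Y s = y₀ := by
  refine tendsto_nhds_unique (hY.tendsto_arc s le_rfl) (tendsto_const_nhds.congr fun k => ?_)
  simp [eulerArc, eulerIndex, eulerNode]

lemma norm_sub_le (hY : IsEulerLimit F g h K s y₀ Y) (ht : s ≤ t) (htt : t ≤ t') (htT : t' ≤ T) :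
    ‖Y t' - Y t‖ ≤ K * eulerBound K s T y₀ * (t' - t) := by
  have hbound : Tendsto (fun k => K * eulerBound K s T y₀ * (t' - t + h k)) F
      (𝓝 (K * eulerBound K s T y₀ * (t' - t + 0))) :=
    (tendsto_const_nhds.add hY.tendsto_step).const_mul _
  rw [add_zero] at hbound
  refine le_of_tendsto_of_tendsto'
    ((hY.tendsto_arc t' (ht.trans htt)).sub (hY.tendsto_arc t ht)).norm hbound fun k => ?_
  exact norm_eulerArc_sub_le (hY.step_pos k) hY.growth_nonneg (hY.norm_le k) ht htt htT

lemma exists_lipschitzOnWith (hY : IsEulerLimit F g h K s y₀ Y) (T : ℝ) :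
    ∃ C : NNReal, LipschitzOnWith C Y (Icc s T) := by
  have hC : 0 ≤ K * eulerBound K s T y₀ :=
    mul_nonneg hY.growth_nonneg (eulerBound_nonneg K s T y₀)
  have hle {t t' : ℝ} (ht : t ∈ Icc s T) (ht' : t' ∈ Icc s T) (htt : t ≤ t') :
      dist (Y t) (Y t') ≤ K * eulerBound K s T y₀ * dist t t' := by
    rw [dist_comm, dist_eq_norm, dist_comm t, Real.dist_eq, abs_of_nonneg (sub_nonneg.mpr htt)]
    exact hY.norm_sub_le ht.1 htt ht'.2
  refine ⟨⟨_, hC⟩, LipschitzOnWith.of_dist_le_mul fun t ht t' ht' => ?_⟩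
  rcases le_total t t' with htt | htt
  · exact hle ht ht' htt
  · rw [dist_comm (Y t), dist_comm t]
    exact hle ht' ht htt

lemma eventually_secant_mem (hY : IsEulerLimit F g h K s y₀ Y) (ht : s ≤ t) {S : Set E}
    (hSc : Convex ℝ S) (hSclosed : IsClosed S)
    (hS : ∀ᶠ q in 𝓝 (t, Y t), ∀ k, g k q.1 q.2 ∈ S) :
    ∀ᶠ t' in 𝓝[>] t, (t' - t)⁻¹ • (Y t' - Y t) ∈ S := by
  filter_upwards [self_mem_nhdsWithin, hY.eventually_eulerNode_mem ht hS] with t' htt' hnodes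
  have hst' : s ≤ t' := ht.trans (mem_Ioi.mp htt').le
  have hpos : 0 < t' - t := sub_pos.mpr htt'
  have hlen : Tendsto (fun k => ((eulerIndex s (h k) t' : ℝ) - eulerIndex s (h k) t) * h k) F
      (𝓝 (t' - t)) :=
    ((hY.tendsto_time hst').sub (hY.tendsto_time ht)).congr fun k => by ring
  refine hSclosed.mem_of_tendsto ((hlen.inv₀ hpos.ne').smul
    ((hY.tendsto_arc t' hst').sub (hY.tendsto_arc t ht))) ?_
  filter_upwards [hlen.eventually (lt_mem_nhds hpos), hnodes] with k hlenk hnode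
  have hij : eulerIndex s (h k) t < eulerIndex s (h k) t' :=
    Nat.cast_lt.mp (sub_pos.mp (pos_of_mul_pos_left hlenk (hY.step_pos k).le))
  exact smul_eulerNode_sub_mem (hY.step_pos k) hij hSc fun l hil hlj => hnode l hil hlj k

lemma mem_of_hasDerivAt (hY : IsEulerLimit F g h K s y₀ Y) (ht : s ≤ t) {y' : E}
    (hy' : HasDerivAt Y y' t) {S : Set E} (hSc : Convex ℝ S) (hSclosed : IsClosed S)
    (hS : ∀ᶠ q in 𝓝 (t, Y t), ∀ k, g k q.1 q.2 ∈ S) : y' ∈ S := by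
  refine hSclosed.mem_of_tendsto ((hasDerivAt_iff_tendsto_slope.mp hy').mono_left
    (nhdsWithin_mono t fun _ hlt => (mem_Ioi.mp hlt).ne'))
    (hY.eventually_secant_mem ht hSc hSclosed hS)

end IsEulerLimit

end Euler

/-! ### Proximal aiming -/

namespace ControlProblem

variable {n m : ℕ} {P : ControlProblem n m} {φ : ℝ → EuclideanSpace ℝ (Fin n) → ℝ} {s : ℝ}

/-- The extended velocity field of the system under the feedback `w`, acting on pairs of an
accumulated cost and a state. -/
noncomputable def closedLoopField (P : ControlProblem n m)
    (w : ℝ → EuclideanSpace ℝ (Fin n) → EuclideanSpace ℝ (Fin m)) (t : ℝ)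
    (y : ℝ × EuclideanSpace ℝ (Fin n)) : ℝ × EuclideanSpace ℝ (Fin n) :=
  P.velocity t y.2 (w t y.2)

lemma Standing.exists_norm_closedLoopField_le (hP : P.Standing) :
    ∃ K : ℝ, 0 < K ∧ ∀ w : ℝ → EuclideanSpace ℝ (Fin n) → EuclideanSpace ℝ (Fin m),
      (∀ t x, w t x ∈ P.Ω) → ∀ t, 0 ≤ t → ∀ y, ‖P.closedLoopField w t y‖ ≤ K * (1 + ‖y‖) := by
  obtain ⟨K, hK, hgrowth⟩ := hP.exists_norm_velocity_le
  refine ⟨K, hK, fun w hw t ht y => (hgrowth t ht y.2 _ (hw t y.2)).trans ?_⟩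
  gcongr
  exact norm_snd_le y

/-- The feedback selects a control that makes the Hamiltonian expression of a supergradient of `V`
almost non-positive. -/
lemma IsRegularization.exists_feedback_step_le (hP : P.Standing)
    {V : ℝ → EuclideanSpace ℝ (Fin n) → ℝ} {T R C ε : ℝ} (hε : 0 < ε)
    (hV : P.IsRegularization φ V T R C ε) (h : ∀ s, 0 ≤ s → ∀ z, P.supHJB φ s z ≤ 0) :
    ∃ w : ℝ → EuclideanSpace ℝ (Fin n) → EuclideanSpace ℝ (Fin m), (∀ t x, w t x ∈ P.Ω) ∧
      ∃ η : ℝ, 0 < η ∧ ∀ t ∈ Icc 0 T, ∀ y : ℝ × EuclideanSpace ℝ (Fin n), ‖y.2‖ ≤ R →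
        ∀ d ∈ Ioo 0 η, V (t + d) (y + d • P.closedLoopField w t y).2 +
          (y + d • P.closedLoopField w t y).1 ≤ V t y.2 + y.1 + 2 * ε * d := by
  have hcontrol : ∀ t x, ∃ v ∈ P.Ω, t ∈ Icc 0 T → ‖x‖ ≤ R →
      ∃ p, p.1 + P.preHamiltonian t x p.2 v ≤ ε ∧ IsProximalSupergradient V C t x p := by
    intro t x
    by_cases htx : t ∈ Icc 0 T ∧ ‖x‖ ≤ R
    · obtain ⟨τ, y, p, hp, hτ, -, -, hH, hsuper⟩ := hV.exists_supergradient t htx.1 x htx.2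
      obtain ⟨v, hv, hle⟩ := (hP.supHJB_nonpos_iff hτ).mp (h τ hτ y) p hp
      exact ⟨v, hv, fun _ _ => ⟨p, by linarith [(abs_le.mp (hH v hv)).2], hsuper⟩⟩
    · obtain ⟨v, hv⟩ := hP.controls_nonempty
      exact ⟨v, hv, fun ht hx => absurd ⟨ht, hx⟩ htx⟩
  choose w hw hdescent using hcontrol
  obtain ⟨K, hK, hgrowth⟩ := hP.exists_norm_velocity_le
  obtain ⟨η, hη, hquad⟩ := exists_forall_mul_sq_add_sq_le (K * (1 + R)) C hε
  refine ⟨w, hw, η, hη, fun t ht y hy d hd => ?_⟩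
  obtain ⟨p, hp, hsuper⟩ := hdescent t y.2 ht hy
  have hvel : ‖d • P.f t y.2 (w t y.2)‖ ≤ K * (1 + R) * |d| := by
    rw [norm_smul, Real.norm_eq_abs, mul_comm]
    gcongr
    exact ((norm_snd_le _).trans (hgrowth t ht.1 _ _ (hw t y.2))).trans (by gcongr)
  have hstep := hsuper (t + d) (y.2 + d • P.f t y.2 (w t y.2))
  have herr := hquad d ‖d • P.f t y.2 (w t y.2)‖ (by rw [abs_of_pos hd.1]; exact hd.2)
    (by rwa [abs_norm])
  rw [add_sub_cancel_left, add_sub_cancel_left, real_inner_smul_right] at hstep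
  rw [abs_of_pos hd.1] at hstep herr
  have hdp := mul_le_mul_of_nonneg_left hp hd.1.le
  simp only [closedLoopField, velocity, preHamiltonian, Prod.snd_add, Prod.fst_add, Prod.smul_snd,
    Prod.smul_fst, smul_eq_mul] at hdp ⊢
  linarith

lemma exists_feedback_eulerNode_le (hP : P.Standing)
    (hφ : ContinuousOn (Function.uncurry φ) {q | 0 ≤ q.1})
    (h : ∀ s, 0 ≤ s → ∀ z, P.supHJB φ s z ≤ 0) (hs : 0 ≤ s) (y₀ : ℝ × EuclideanSpace ℝ (Fin n))
    (T : ℝ) {ε : ℝ} (hε : 0 < ε) :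
    ∃ w : ℝ → EuclideanSpace ℝ (Fin n) → EuclideanSpace ℝ (Fin m), (∀ t x, w t x ∈ P.Ω) ∧
      ∃ d ∈ Ioo 0 ε, ∀ i j : ℕ, i ≤ j → s + j * d ≤ T →
        φ (s + j * d) (eulerNode (P.closedLoopField w) s y₀ d j).2 +
            (eulerNode (P.closedLoopField w) s y₀ d j).1 ≤
          φ (s + i * d) (eulerNode (P.closedLoopField w) s y₀ d i).2 +
            (eulerNode (P.closedLoopField w) s y₀ d i).1 + ε := by
  obtain ⟨K, hK, hgrowth⟩ := hP.exists_norm_closedLoopField_le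
  set ε' := ε / (2 * (1 + |T - s|))
  have hε' : 0 < ε' := by positivity
  obtain ⟨V, C, hV⟩ := hP.exists_isRegularization hφ T (eulerBound K s T y₀) hε'
  obtain ⟨w, hw, η, hη, hstep⟩ := hV.exists_feedback_step_le hP hε' h
  obtain ⟨d, hd, hdmin⟩ := exists_between (lt_min hε hη)
  refine ⟨w, hw, d, ⟨hd, hdmin.trans_le (min_le_left _ _)⟩, fun i j hij hj => ?_⟩
  set y := eulerNode (P.closedLoopField w) s y₀ d
  have hmem {k : ℕ} (hk : s + k * d ≤ T) : s + k * d ∈ Icc 0 T := ⟨by positivity, hk⟩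
  have hle {k : ℕ} (hk : s + k * d ≤ T) : ‖(y k).2‖ ≤ eulerBound K s T y₀ :=
    ((norm_snd_le _).trans (lt_one_add _).le).trans <| one_add_norm_eulerNode_le hd hK.le
      (fun t ht => hgrowth w hw t (hs.trans ht)) hk
  have hchain : V (s + j * d) (y j).2 + (y j).1 ≤
      V (s + i * d) (y i).2 + (y i).1 + 2 * ε' * ((j - i) * d) :=
    eulerNode_le_of_step_le (W := fun t (x : ℝ × EuclideanSpace ℝ (Fin n)) => V t x.2 + x.1) hd
      (fun k hk => hstep _ (hmem hk) (y k) (hle hk) d ⟨hd, hdmin.trans_le (min_le_right _ _)⟩)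
      hij hj
  have hij' : (i : ℝ) * d ≤ j * d := by gcongr
  have hi : s + i * d ≤ T := by linarith
  have hVi := abs_le.mp (hV.abs_sub_le _ (hmem hi) _ (hle hi))
  have hVj := abs_le.mp (hV.abs_sub_le _ (hmem hj) _ (hle hj))
  have hlen : ((j : ℝ) - i) * d ≤ |T - s| := by
    have : 0 ≤ (i : ℝ) * d := by positivity
    linarith [le_abs_self (T - s)]
  have hsum : 2 * ε' + 2 * ε' * ((j - i) * d) ≤ ε := by
    calc 2 * ε' + 2 * ε' * ((j - i) * d) ≤ 2 * ε' + 2 * ε' * |T - s| := by gcongr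
      _ = ε := by simp only [ε']; field_simp
  linarith

lemma exists_isEulerLimit_nonincreasing (hP : P.Standing)
    (hφ : ContinuousOn (Function.uncurry φ) {q | 0 ≤ q.1})
    (h : ∀ s, 0 ≤ s → ∀ z, P.supHJB φ s z ≤ 0) (hs : 0 ≤ s)
    (y₀ : ℝ × EuclideanSpace ℝ (Fin n)) :
    ∃ (w : ℕ → ℝ → EuclideanSpace ℝ (Fin n) → EuclideanSpace ℝ (Fin m)) (d : ℕ → ℝ) (K : ℝ)
      (Y : ℝ → ℝ × EuclideanSpace ℝ (Fin n)), (∀ k t x, w k t x ∈ P.Ω) ∧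
      IsEulerLimit (hyperfilter ℕ : Filter ℕ) (fun k => P.closedLoopField (w k)) d K s y₀ Y ∧
      ∀ a b, s ≤ a → a ≤ b → φ b (Y b).2 + (Y b).1 ≤ φ a (Y a).2 + (Y a).1 := by
  choose w hw d hd hle using fun k : ℕ => exists_feedback_eulerNode_le hP hφ h hs y₀ (s + k)
    (ε := 1 / ((k : ℝ) + 1)) (by positivity)
  obtain ⟨K, hK, hgrowth⟩ := hP.exists_norm_closedLoopField_le
  have hε : Tendsto (fun k : ℕ => 1 / ((k : ℝ) + 1)) (hyperfilter ℕ) (𝓝 0) :=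
    tendsto_one_div_add_atTop_nhds_zero_nat.mono_left Nat.hyperfilter_le_atTop
  have hd0 : Tendsto d (hyperfilter ℕ) (𝓝 0) :=
    squeeze_zero (fun k => (hd k).1.le) (fun k => (hd k).2.le) hε
  obtain ⟨Y, hY⟩ := exists_isEulerLimit (hyperfilter ℕ) hK.le
    (fun k t ht => hgrowth (w k) (hw k) t (hs.trans ht)) (fun k => (hd k).1) hd0 y₀
  refine ⟨w, d, K, Y, hw, hY, fun a b ha hab => ?_⟩
  have hψ : ContinuousOn (fun q : ℝ × ℝ × EuclideanSpace ℝ (Fin n) => φ q.1 q.2.2 + q.2.1)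
      {q | s ≤ q.1} :=
    (hφ.comp (f := fun q : ℝ × ℝ × EuclideanSpace ℝ (Fin n) => (q.1, q.2.2))
      (Continuous.continuousOn (by fun_prop)) fun _ hq => hs.trans hq).add
      (Continuous.continuousOn (by fun_prop))
  have hlim := (hY.tendsto_comp hψ ha).add hε
  rw [add_zero] at hlim
  refine le_of_tendsto_of_tendsto (hY.tendsto_comp hψ (ha.trans hab)) hlim ?_
  filter_upwards [Nat.hyperfilter_le_atTop
    (tendsto_natCast_atTop_atTop.eventually (eventually_ge_atTop (b - s)))] with k hk
  exact hle k _ _ (eulerIndex_le_eulerIndex (hd k).1 hab)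
    (by linarith [eulerIndex_mul_le (hd k).1 (ha.trans hab)])

lemma deriv_mem_image_velocity_of_isEulerLimit (hP : P.Standing) (hs : 0 ≤ s) {ι : Type*}
    {F : Filter ι} [F.NeBot]
    {w : ι → ℝ → EuclideanSpace ℝ (Fin n) → EuclideanSpace ℝ (Fin m)} (hw : ∀ k t x, w k t x ∈ P.Ω)
    {d : ι → ℝ} {K : ℝ} {y₀ : ℝ × EuclideanSpace ℝ (Fin n)}
    {Y : ℝ → ℝ × EuclideanSpace ℝ (Fin n)}
    (hY : IsEulerLimit F (fun k => P.closedLoopField (w k)) d K s y₀ Y) {t : ℝ} (ht : s < t)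
    (hdiff : DifferentiableAt ℝ Y t) : deriv Y t ∈ P.velocity t (Y t).2 '' P.Ω := by
  have ht0 : 0 < t := hs.trans_lt ht
  have hcompact : IsCompact (P.velocity t (Y t).2 '' P.Ω) :=
    hP.compact_controls.image (hP.continuous_velocity ht0.le _)
  have hconvex : Convex ℝ (P.velocity t (Y t).2 '' P.Ω) := hP.convex_velocities t ht0.le _
  rw [← hcompact.isClosed.closure_eq, Metric.closure_eq_iInter_cthickening, mem_iInter₂]
  intro ε hε
  refine hY.mem_of_hasDerivAt ht.le hdiff.hasDerivAt (hconvex.cthickening ε)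
    Metric.isClosed_cthickening ?_
  obtain ⟨η, hη, hmod⟩ := hP.exists_velocity_modulus (t + 1) (‖(Y t).2‖ + 1) hε
  have hnear : ∀ᶠ q in 𝓝 (t, Y t), q.1 ∈ Ioo 0 (t + 1) ∧ dist q (t, Y t) < min 1 η :=
    (continuousAt_fst.eventually (Ioo_mem_nhds ht0 (lt_add_one t))).and
      (Metric.ball_mem_nhds _ (lt_min one_pos hη))
  filter_upwards [hnear] with q ⟨hqt, hq⟩ k
  have hqη : |q.1 - t| < η := (le_max_left _ _).trans_lt (hq.trans_le (min_le_right _ _))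
  have hqY : ‖q.2.2 - (Y t).2‖ < min 1 η := by
    rw [← dist_eq_norm]
    exact ((le_max_right _ _).trans (le_max_right _ _)).trans_lt hq
  have hbound : ‖q.2.2‖ ≤ ‖(Y t).2‖ + 1 := by
    linarith [norm_sub_norm_le q.2.2 (Y t).2, min_le_left 1 η]
  refine Metric.mem_cthickening_of_dist_le _ _ _ _ (mem_image_of_mem _ (hw k q.1 q.2.2)) ?_
  rw [dist_eq_norm]
  exact hmod _ ⟨hqt.1.le, hqt.2.le⟩ t ⟨ht0.le, (lt_add_one t).le⟩ _ _ hbound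
    (lt_add_one _).le hqη (hqY.trans_le (min_le_right _ _)) _ (hw k q.1 q.2.2)

end ControlProblem

/-! ### Filippov's lemma -/

section LocallyLipschitz

variable {E : Type*} [NormedAddCommGroup E] {Y : ℝ → E} {s : ℝ}

lemma continuousOn_Ici_of_lipschitzOnWith
    (hY : ∀ T, ∃ C : NNReal, LipschitzOnWith C Y (Icc s T)) : ContinuousOn Y (Ici s) := by
  intro t ht
  obtain ⟨C, hC⟩ := hY (t + 1)
  refine (hC.continuousOn t ⟨ht, (lt_add_one t).le⟩).mono_of_mem_nhdsWithin ?_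
  rw [← Ici_inter_Iic]
  exact inter_mem_nhdsWithin _ (Iic_mem_nhds (lt_add_one t))

lemma ae_differentiableAt_of_lipschitzOnWith [NormedSpace ℝ E] [FiniteDimensional ℝ E]
    (hY : ∀ T, ∃ C : NNReal, LipschitzOnWith C Y (Icc s T)) :
    ∀ᵐ t, s < t → DifferentiableAt ℝ Y t := by
  have hwithin : ∀ N : ℕ, ∀ᵐ t, t ∈ Icc s (s + N) →
      DifferentiableWithinAt ℝ Y (Icc s (s + N)) t := fun N =>
    let ⟨_, hC⟩ := hY (s + N)
    hC.ae_differentiableWithinAt_of_mem_real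
  filter_upwards [ae_all_iff.mpr hwithin] with t ht hst
  obtain ⟨N, hN⟩ := exists_nat_gt (t - s)
  have htN : t < s + N := by linarith
  exact (ht N ⟨hst.le, htN.le⟩).differentiableAt (Icc_mem_nhds hst htN)

end LocallyLipschitz

namespace ControlProblem

variable {n m : ℕ} {P : ControlProblem n m} {s : ℝ} {Y : ℝ → ℝ × EuclideanSpace ℝ (Fin n)}
  {u : ℝ → EuclideanSpace ℝ (Fin m)}

lemma exists_measurable_velocity_eq_deriv (hP : P.Standing) (hs : 0 ≤ s)
    (hYc : ContinuousOn Y (Ici s))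
    (hmem : ∀ t, s < t → DifferentiableAt ℝ Y t → deriv Y t ∈ P.velocity t (Y t).2 '' P.Ω) :
    ∃ u : ℝ → EuclideanSpace ℝ (Fin m), Measurable u ∧ (∀ t, u t ∈ P.Ω) ∧
      ∀ t, s < t → DifferentiableAt ℝ Y t → P.velocity t (Y t).2 (u t) = deriv Y t := by
  have hYmax : Continuous fun t => Y (max t s) :=
    continuousOn_univ.mp <| hYc.comp (by fun_prop) fun t _ => le_max_right t s
  obtain ⟨u, hum, hu⟩ := exists_measurable_isMinOn hP.compact_controls hP.controls_nonempty
    (g := fun t v => ‖P.velocity (max t 0) (Y (max t s)).2 v - deriv Y t‖)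
    (fun t => ((hP.continuous_velocity (le_max_right t 0) _).sub
      continuous_const).norm.continuousOn)
    (fun v _ => by
      refine Measurable.norm (Measurable.sub (Continuous.measurable ?_) (measurable_deriv Y))
      exact continuousOn_univ.mp <| hP.continuousOn_velocity.comp
        (f := fun t : ℝ => (max t 0, (Y (max t s)).2, v))
        ((continuous_id.max continuous_const).prodMk
          (hYmax.snd.prodMk continuous_const)).continuousOn fun t _ => le_max_right t 0)
  refine ⟨u, hum, fun t => (hu t).1, fun t ht hd => ?_⟩
  obtain ⟨v, hv, hvd⟩ := hmem t ht hd
  have hmin := (hu t).2 hv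
  simp only [mem_ofPred_eq, max_eq_left ht.le, max_eq_left (hs.trans ht.le), hvd, sub_self,
    norm_zero] at hmin
  exact sub_eq_zero.mp (norm_le_zero_iff.mp hmin)

lemma locallyIntegrableOn_velocity (hP : P.Standing) (hs : 0 ≤ s) (hYc : ContinuousOn Y (Ici s))
    (hu : ∀ t, u t ∈ P.Ω) (hvel : ∀ᵐ t, s < t → P.velocity t (Y t).2 (u t) = deriv Y t) :
    LocallyIntegrableOn (fun t => P.velocity t (Y t).2 (u t)) (Ici s) := by
  rw [locallyIntegrableOn_iff isClosed_Ici.isLocallyClosed]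
  intro k hk hkc
  obtain ⟨K, hK, hgrowth⟩ := hP.exists_norm_velocity_le
  obtain ⟨R, hR⟩ := hkc.exists_bound_of_continuousOn (hYc.mono hk)
  have hae : ∀ᵐ t ∂volume.restrict k, deriv Y t = P.velocity t (Y t).2 (u t) := by
    rw [ae_restrict_iff' hkc.measurableSet]
    filter_upwards [hvel, Measure.ae_ne volume s] with t ht hts htk
    exact (ht ((mem_Ici.mp (hk htk)).lt_of_ne' hts)).symm
  refine IntegrableOn.of_bound hkc.measure_lt_top
    ((measurable_deriv Y).aestronglyMeasurable.congr hae) (K * (1 + R)) ?_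
  refine (ae_restrict_iff' hkc.measurableSet).mpr (Eventually.of_forall fun t ht => ?_)
  refine (hgrowth t (hs.trans (hk ht)) _ _ (hu t)).trans ?_
  gcongr
  exact (norm_snd_le _).trans (hR t ht)

lemma locallyIntegrableOn_control (hP : P.Standing) (hum : Measurable u) (hu : ∀ t, u t ∈ P.Ω)
    (A : Set ℝ) : LocallyIntegrableOn u A := by
  obtain ⟨M, hM⟩ := hP.compact_controls.isBounded.exists_norm_le
  exact ((locallyIntegrable_const M).mono hum.aestronglyMeasurable (Eventually.of_forall fun t =>
    (hM _ (hu t)).trans (le_abs_self M))).locallyIntegrableOn A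

/-- Filippov's lemma, with the accumulated cost as the first entry of the curve. -/
lemma exists_isAdmissible_of_deriv_mem (hP : P.Standing) (hs : 0 ≤ s)
    (hY : ∀ T, ∃ C : NNReal, LipschitzOnWith C Y (Icc s T))
    (hmem : ∀ t, s < t → DifferentiableAt ℝ Y t → deriv Y t ∈ P.velocity t (Y t).2 '' P.Ω) :
    ∃ u, P.IsAdmissible s (Y s).2 (fun t => (Y t).2) u ∧ ∀ a b, s ≤ a → a ≤ b →
      ∫ r in a..b, P.discountedCost (fun t => (Y t).2) u r = (Y b).1 - (Y a).1 := by
  have hYc := continuousOn_Ici_of_lipschitzOnWith hY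
  have hdiff := ae_differentiableAt_of_lipschitzOnWith hY
  obtain ⟨u, hum, hu, hvel⟩ := exists_measurable_velocity_eq_deriv hP hs hYc hmem
  have hloc := locallyIntegrableOn_velocity hP hs hYc hu
    (hdiff.mono fun t ht hst => hvel t hst (ht hst))
  have hint (a b : ℝ) (ha : s ≤ a) (hab : a ≤ b) :=
    intervalIntegrable_of_locallyIntegrableOn_Ici hloc ha (ha.trans hab)
  have hFTC : ∀ a b, s ≤ a → a ≤ b → ∫ t in a..b, P.velocity t (Y t).2 (u t) = Y b - Y a := by
    intro a b ha hab
    obtain ⟨C, hC⟩ := hY b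
    refine intervalIntegral_eq_sub_of_lipschitzOnWith hab (hC.mono (Icc_subset_Icc_left ha)) ?_
      (hint a b ha hab)
    filter_upwards [hdiff] with t ht hab
    rw [hvel t (ha.trans_lt hab.1) (ht (ha.trans_lt hab.1))]
    exact (ht (ha.trans_lt hab.1)).hasDerivAt
  refine ⟨u, ⟨locallyIntegrableOn_control hP hum hu _, Eventually.of_forall hu,
    fun t ht => ?_, fun t ht => ?_⟩, fun a b ha hab => ?_⟩
  · obtain ⟨U, hU, hUint⟩ := hloc t ht
    exact ⟨U, hU, hUint.snd⟩
  · have hsnd := (ContinuousLinearMap.snd ℝ ℝ (EuclideanSpace ℝ (Fin n))).intervalIntegral_comp_comm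
      (hint s t le_rfl ht)
    rw [hFTC s t le_rfl ht] at hsnd
    exact eq_add_of_sub_eq' hsnd.symm
  · have hfst := (ContinuousLinearMap.fst ℝ ℝ (EuclideanSpace ℝ (Fin n))).intervalIntegral_comp_comm
      (hint a b ha hab)
    rwa [hFTC a b ha hab] at hfst

theorem nonincreasingAlongSome_of_supHJB_nonpos (hP : P.Standing)
    {φ : ℝ → EuclideanSpace ℝ (Fin n) → ℝ}
    (hφ : ContinuousOn (Function.uncurry φ) {q | 0 ≤ q.1})
    (hfin : ∀ τ : ℝ, 0 ≤ τ → ∀ z x u, P.IsAdmissible τ z x u → (x, u) ∈ P.finiteCostProcesses τ z)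
    (h : ∀ s, 0 ≤ s → ∀ z, P.supHJB φ s z ≤ 0) : P.NonincreasingAlongSome φ := by
  intro s hs z
  obtain ⟨w, d, K, Y, hw, hY, hle⟩ := exists_isEulerLimit_nonincreasing hP hφ h hs (0, z)
  obtain ⟨u, hadm, hcost⟩ := exists_isAdmissible_of_deriv_mem hP hs hY.exists_lipschitzOnWith
    fun t ht => deriv_mem_image_velocity_of_isEulerLimit hP hs hw hY ht
  rw [hY.apply_start] at hadm
  have hproc := hfin s hs z _ u hadm
  refine ⟨_, hproc, fun a ha b hb hab => ?_⟩
  linarith [pathValue_sub φ hproc.2 ha hb, hcost a b ha hab, hle a b ha hab]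

end ControlProblem

theorem proposition3p1 {n m : ℕ} (P : ControlProblem n m) (hP : P.Standing)
    (φ : ℝ → EuclideanSpace ℝ (Fin n) → ℝ)
    (hφ : ContinuousOn (fun q : ℝ × EuclideanSpace ℝ (Fin n) => φ q.1 q.2) {q | 0 ≤ q.1}) :
    -- (a)
    (((∀ s : ℝ, 0 < s → ∀ z : EuclideanSpace ℝ (Fin n), 0 ≤ P.infHJB φ s z) →
        P.NondecreasingAlongEvery φ) ∧
      ((∀ τ : ℝ, 0 ≤ τ → ∀ z, (P.finiteCostProcesses τ z).Nonempty) →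
        P.NondecreasingAlongEvery φ →
        ∀ s : ℝ, 0 < s → ∀ z : EuclideanSpace ℝ (Fin n), 0 ≤ P.infHJB φ s z)) ∧
    -- (b)
    (((∀ s : ℝ, 0 ≤ s → ∀ z : EuclideanSpace ℝ (Fin n), P.supMaxHJB φ s z ≤ 0) →
        P.NonincreasingAlongEvery φ) ∧
      ((∀ τ : ℝ, 0 ≤ τ → ∀ z, (P.finiteCostProcesses τ z).Nonempty) →
        P.NonincreasingAlongEvery φ →
        ∀ s : ℝ, 0 ≤ s → ∀ z : EuclideanSpace ℝ (Fin n), P.supMaxHJB φ s z ≤ 0)) ∧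
    -- (c)
    ((P.NonincreasingAlongSome φ →
        ∀ s : ℝ, 0 ≤ s → ∀ z : EuclideanSpace ℝ (Fin n), P.supHJB φ s z ≤ 0) ∧
      ((∀ τ : ℝ, 0 ≤ τ → ∀ z x u, P.IsAdmissible τ z x u →
          (x, u) ∈ P.finiteCostProcesses τ z) →
        (∀ s : ℝ, 0 ≤ s → ∀ z : EuclideanSpace ℝ (Fin n), P.supHJB φ s z ≤ 0) →
        P.NonincreasingAlongSome φ)) := by
  open ControlProblem in
  exact ⟨⟨nondecreasingAlongEvery_of_infHJB_nonneg hP hφ,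
      fun hne h _ hs z => infHJB_nonneg_of_nondecreasingAlongEvery hP hne h hs z⟩,
    ⟨nonincreasingAlongEvery_of_supMaxHJB_nonpos hP hφ,
      fun hne h _ hs z => supMaxHJB_nonpos_of_nonincreasingAlongEvery hP hne h hs z⟩,
    ⟨fun h _ hs z => supHJB_nonpos_of_nonincreasingAlongSome hP h hs z,
      nonincreasingAlongSome_of_supHJB_nonpos hP hφ⟩⟩
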